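/- **Setting.** Let $(\mathbf x_i,y_i)_{i=1}^n$ be training data with $\mathbf x_i\in\mathbb R^d$, $\|\mathbf x_i\|_1\le R$ and labels $y_i\in\{1,\dots,k\}$, $k\ge 2$. Let $\|\cdot\|$ be any entry-wise or Schatten $p$-norm on $\mathbb R^{k\times d}$, $1\le p\le\infty$. Assume that the data are linearly separable, i.e. some $\mathbf W$ satisfies $(\mathbf e_{y_i}-\mathbf e_c)^\top\mathbf W\mathbf x_i>0$ for all $i$ and all $c\ne y_i$, and let $$\gamma=\max_{\|\mathbf W\|\le1}\ \min_{i,\;c\neq y_i}(\mathbf e_{y_i}-\mathbf e_c)^\top\mathbf W\mathbf x_i>0 .$$ For $B\subseteq\{1,\dots,n\}$ let $\mathcal L_B(\mathbf W)=-\frac1{|B|}\sum_{i\in B}\log\mathbb S_{y_i}(\mathbf W\mathbf x_i)$ be the cross-entropy loss ($\mathbb S$ is the softmax map), and $\mathcal L=\mathcal L_{\{1,\dots,n\}}$. Let $n=mb$ with integers $m,b\ge 1$. In each epoch, consisting of the iterations $t=em,\dots,em+m-1$, the training set is partitioned (by random reshuffling) into $m$ mini-batches $\mathcal B_t$ of size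 $b$. Let $\beta_1\in[0,1)$, $a\in(0,1]$, $c>0$, $\eta_t=c\,t^{-a}$ for $t\ge1$ and $0\le\eta_0\le c$. Variance-reduced stochastic steepest descent from $\mathbf W_0$ is the iteration $$\mathbf V_t=\nabla\mathcal L_{\mathcal B_t}(\mathbf W_t)-\nabla\mathcal L_{\mathcal B_t}(\tilde{\mathbf W}_t)+\nabla\mathcal L(\tilde{\mathbf W}_t),\qquad \mathbf M_t=\beta_1\mathbf M_{t-1}+(1-\beta_1)\mathbf V_t,\quad \mathbf M_{-1}=0,$$ $$\mathbf W_{t+1}=\mathbf W_t-\eta_t\boldsymbol\Delta_t,\qquad \boldsymbol\Delta_t\in\arg\max_{\|\boldsymbol\Delta\|\le1}\langle\mathbf M_t,\boldsymbol\Delta\rangle ,$$ where $\tilde{\mathbf W}_t$ is the iterate at the beginning of the epoch containing $t$; the maximizer may be chosen arbitrarily. For $\beta_1=0$ we have $\mathbf M_t=\mathbf V_t$, which is the case without momentum. **Claim.** There is a constant $C>0$, depending only on $a,c,R,\gamma$ and on upper bounds $\omega\ge\|\mathbf W_0\|$ and $\Lambda\ge\mathcal L(\mathbf W_0)$, and for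 all $n,m,b,\beta_1$ as above there is a time $t_2$, depending only on $n,m,b,\beta_1$ and on $a,c,R,\gamma,\omega,\Lambda$, such that for every such data set (in any dimensions $k,d$), every such norm, every realization of the mini-batches, every choice of the maximizers and every $t>t_2$ we have $\mathbf W_t\ne0$ and $$\gamma-\frac{\min_{i,\,c\neq y_i}(\mathbf e_{y_i}-\mathbf e_c)^\top\mathbf W_t\mathbf x_i}{\|\mathbf W_t\|}\ \le\ C\cdot\begin{cases} \dfrac{n\left(\frac{m^{2+a}}{1-\beta_1}\right)^{\frac1a-1}+\frac{m^{2+a}}{1-\beta_1}\,t^{1-2a}}{t^{1-a}}, & a<\frac12,\\[2ex] \dfrac{\frac{m^{5/2}}{1-\beta_1}\,(n+\log t)}{t^{1/2}}, & a=\frac12,\\[2ex] \dfrac{n\left(\frac{m^{2+a}}{1-\beta_1}\right)^{\frac1a-1}+\frac{m^{2+a}}{1-\beta_1}}{t^{1-a}}, & \frac12<a<1,\\[2ex] \dfrac{n\left(1+\log\frac{m^{3}}{1-\beta_1}\right)+\frac{m^{3}}{1-\beta_1}}{\log t}, & a=1. \end{cases}$$ -/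

import Mathlib

open scoped ENNReal Matrix

namespace VRSteepest

noncomputable section

variable {n k d : ℕ}

/-- Entry-wise `p`-norm of a matrix: the `ℓ_p` norm of the family of all its entries
(for `p = ∞` the largest absolute value of an entry). -/
def entrywiseNorm (p : ℝ≥0∞) (X : Matrix (Fin k) (Fin d) ℝ) : ℝ :=
  ‖(WithLp.toLp p (fun q : Fin k × Fin d => X q.1 q.2) : PiLp p fun _ : Fin k × Fin d => ℝ)‖

/-- Schatten `p`-norm of a matrix: the `ℓ_p` norm of its singular values, listed with
multiplicity in decreasing order and padded by zeros to length `d`. -/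
def schattenNorm (p : ℝ≥0∞) (X : Matrix (Fin k) (Fin d) ℝ) : ℝ :=
  ‖(WithLp.toLp p (fun j : Fin d => (Matrix.toEuclideanLin X).singularValues j) :
    PiLp p fun _ : Fin d => ℝ)‖

/-- `N` is one of the entry-wise or Schatten `p`-norms, `1 ≤ p ≤ ∞`. -/
def IsEntrywiseOrSchatten (N : Matrix (Fin k) (Fin d) ℝ → ℝ) : Prop :=
  ∃ p : ℝ≥0∞, 1 ≤ p ∧ (N = entrywiseNorm p ∨ N = schattenNorm p)

/-- The softmax map. -/
def softmax (v : Fin k → ℝ) (c : Fin k) : ℝ :=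
  Real.exp (v c) / ∑ j, Real.exp (v j)

/-- Cross-entropy loss of the logits `v` for the label `y`. -/
def crossEntropy (v : Fin k → ℝ) (y : Fin k) : ℝ :=
  -Real.log (softmax v y)

/-- Average cross-entropy loss of the linear classifier `W` over the samples in `B`. -/
def batchLoss (x : Fin n → Fin d → ℝ) (y : Fin n → Fin k) (B : Finset (Fin n))
    (W : Matrix (Fin k) (Fin d) ℝ) : ℝ :=
  (B.card : ℝ)⁻¹ * ∑ i ∈ B, crossEntropy (W *ᵥ x i) (y i)

/-- Empirical loss: the average over the whole training set. -/
def fullLoss (x : Fin n → Fin d → ℝ) (y : Fin n → Fin k)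
    (W : Matrix (Fin k) (Fin d) ℝ) : ℝ :=
  batchLoss x y Finset.univ W

/-- Gradient of a function of a matrix: the matrix of its partial derivatives. -/
def matGrad (f : Matrix (Fin k) (Fin d) ℝ → ℝ) (W : Matrix (Fin k) (Fin d) ℝ) :
    Matrix (Fin k) (Fin d) ℝ :=
  Matrix.of fun c j => deriv (fun s : ℝ => f (W + s • Matrix.single c j (1 : ℝ))) 0

/-- The margin `min_{i, c ≠ y_i} (e_{y_i} - e_c)ᵀ W x_i` of `W` on the training set. -/
def minMargin (x : Fin n → Fin d → ℝ) (y : Fin n → Fin k)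
    (W : Matrix (Fin k) (Fin d) ℝ) : ℝ :=
  ⨅ q : {q : Fin n × Fin k // q.2 ≠ y q.1},
    ((W *ᵥ x q.1.1) (y q.1.1) - (W *ᵥ x q.1.1) q.1.2)

/-- The maximal margin over the unit ball of `N`. -/
def maxMargin (N : Matrix (Fin k) (Fin d) ℝ → ℝ)
    (x : Fin n → Fin d → ℝ) (y : Fin n → Fin k) : ℝ :=
  sSup (minMargin x y '' {W | N W ≤ 1})

/-- Linear separability of the training set. -/
def Separable (x : Fin n → Fin d → ℝ) (y : Fin n → Fin k) : Prop :=
  ∃ W : Matrix (Fin k) (Fin d) ℝ, ∀ i, ∀ c, c ≠ y i → 0 < (W *ᵥ x i) (y i) - (W *ᵥ x i) c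

/-- A realization of random reshuffling: `B t` is the mini-batch used at iteration `t`, every
mini-batch has `b` samples, and within each epoch `e` the `m` mini-batches
`B (e * m), …, B (e * m + m - 1)` partition the training set. -/
def IsReshuffling (m b : ℕ) (B : ℕ → Finset (Fin n)) : Prop :=
  (∀ t, (B t).card = b) ∧ ∀ e : ℕ, ∀ i : Fin n, ∃! j : ℕ, j < m ∧ i ∈ B (e * m + j)

/-- The step sizes `η_t = c t^{-a}` for `t ≥ 1`, with a separate initial value `η_0`. -/
def stepSize (a c η₀ : ℝ) (t : ℕ) : ℝ :=
  if t = 0 then η₀ else c * (t : ℝ) ^ (-a)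

/-- The variance-reduced gradient `V_t`; the snapshot is the iterate at the beginning
`t / m * m` of the epoch that contains `t`. -/
def vrGrad (x : Fin n → Fin d → ℝ) (y : Fin n → Fin k) (m : ℕ) (B : ℕ → Finset (Fin n))
    (W : ℕ → Matrix (Fin k) (Fin d) ℝ) (t : ℕ) : Matrix (Fin k) (Fin d) ℝ :=
  matGrad (batchLoss x y (B t)) (W t) - matGrad (batchLoss x y (B t)) (W (t / m * m))
    + matGrad (fullLoss x y) (W (t / m * m))

/-- Exponential moving average `M_t = β M_{t-1} + (1 - β) V_t` with `M_{-1} = 0`.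
For `β = 0` this is `V_t` itself, i.e. there is no momentum. -/
def momentum (β : ℝ) (V : ℕ → Matrix (Fin k) (Fin d) ℝ) : ℕ → Matrix (Fin k) (Fin d) ℝ
  | 0 => (1 - β) • V 0
  | t + 1 => β • momentum β V t + (1 - β) • V (t + 1)

/-- `D` maximizes `⟨G, D⟩ = tr (Gᵀ D)` over the unit ball of `N`. -/
def IsSteepest (N : Matrix (Fin k) (Fin d) ℝ → ℝ) (G D : Matrix (Fin k) (Fin d) ℝ) : Prop :=
  N D ≤ 1 ∧ ∀ E, N E ≤ 1 → (Gᵀ * E).trace ≤ (Gᵀ * D).trace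

/-- `W` is a trajectory of variance-reduced stochastic steepest descent with momentum `β`,
step sizes `η` and mini-batches `B` (for some choice of the maximizers). -/
def IsVRTrajectory (N : Matrix (Fin k) (Fin d) ℝ → ℝ)
    (x : Fin n → Fin d → ℝ) (y : Fin n → Fin k) (m : ℕ) (B : ℕ → Finset (Fin n))
    (β : ℝ) (η : ℕ → ℝ) (W : ℕ → Matrix (Fin k) (Fin d) ℝ) : Prop :=
  ∃ D : ℕ → Matrix (Fin k) (Fin d) ℝ, ∀ t,
    IsSteepest N (momentum β (vrGrad x y m B W) t) (D t) ∧ W (t + 1) = W t - η t • D t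

/-- The margin gap `γ - min_{i, c ≠ y_i} (e_{y_i} - e_c)ᵀ W x_i / ‖W‖`. -/
def marginGap (N : Matrix (Fin k) (Fin d) ℝ → ℝ)
    (x : Fin n → Fin d → ℝ) (y : Fin n → Fin k) (W : Matrix (Fin k) (Fin d) ℝ) : ℝ :=
  maxMargin N x y - minMargin x y W / N W

end

end VRSteepest

/-! Everything is measured against the average misclassification probability G = `avgMiss`. If the
entries of W move by at most r, then G changes by a factor of at most exp(2rR) and the full gradient
changes in entry-wise ℓ₁ norm by at most 2R(exp(2rR) − 1)G. Every admissible norm dominates the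
largest entry, so its unit ball lies in the entry-wise cube. Pairings are then controlled by ℓ₁
norms, with constants free of k, d and p.

A mini-batch gradient changes by at most n/b = m times such a bound, and a snapshot is less than m
steps old. The error of the momentum relative to G is therefore contracted by β exp(2Rη_t) and
driven by terms of order η_t and (1 − β)m²η_t (`relError_succ_le`). After a burn-in time T' it is
O(Xη_t) with X = m²/(1 − β) (`ErrorRecursion.le_stepSize`). From then on each step lowers the loss L
by at least h_t G, where h_t = η_t(γ − A X η_t) and A = `driftConst` (`fullLoss_succ_le`).

Since exp(−nL) is the product of the probabilities of the correct labels, 1 − exp(−nL) ≤ nG.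
Convexity of exp then shrinks exp(nL) − 1 by the factor exp(−h_t) at every step, however large the
loss still is (`exp_loss_sub_one_le`). This potential dominates exp(−margin), so the margin is at
least Σ h_s − nL(W_{T'}), while the norm is at most ω + Σ η_s. Dividing bounds the gap by a constant
times (n(1 + Σ_{s<T'} s^{-a}) + X Σ_{s<t} s^{-2a}) / Σ_{s<t} s^{-a} (`marginGap_le`). The four cases
are the growth rates of these sums, with T' = O(X^{1/a}) for a < 1 and T' = O(X²) for a = 1
(`exists_times`). -/

namespace VRSteepest

/-! ### Contractions of ℓ_p norms -/

/-- A doubly substochastic matrix is a contraction for the `ℓ_p` norms. -/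
theorem lp_norm_le_of_substochastic {ι : Type*} [Fintype ι] (p : ℝ≥0∞) (hp : 1 ≤ p)
    (P : ι → ι → ℝ) (hP : ∀ i j, 0 ≤ P i j) (hrow : ∀ i, ∑ j, P i j ≤ 1)
    (hcol : ∀ j, ∑ i, P i j ≤ 1) (r s : ι → ℝ) (hr : ∀ i, |r i| ≤ ∑ j, P i j * |s j|) :
    ‖(WithLp.toLp p r : PiLp p fun _ : ι => ℝ)‖ ≤
      ‖(WithLp.toLp p s : PiLp p fun _ : ι => ℝ)‖ := by
  have : Fact (1 ≤ p) := ⟨hp⟩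
  rcases eq_or_ne p ∞ with rfl | hpt
  · have h0 : 0 ≤ ‖(WithLp.toLp ∞ s : PiLp ∞ fun _ : ι => ℝ)‖ := norm_nonneg _
    rw [PiLp.norm_eq_ciSup (WithLp.toLp ∞ r)]
    refine Real.iSup_le (fun i => ?_) h0
    calc ‖r i‖ ≤ ∑ j, P i j * |s j| := hr i
      _ ≤ ∑ j, P i j * ‖(WithLp.toLp ∞ s : PiLp ∞ fun _ : ι => ℝ)‖ := by
          gcongr with j
          · exact hP i j
          · exact PiLp.norm_apply_le (WithLp.toLp ∞ s : PiLp ∞ fun _ : ι => ℝ) j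
      _ ≤ 1 * ‖(WithLp.toLp ∞ s : PiLp ∞ fun _ : ι => ℝ)‖ := by
          rw [← Finset.sum_mul]
          exact mul_le_mul_of_nonneg_right (hrow i) h0
      _ = _ := one_mul _
  · have hq : 0 < p.toReal := ENNReal.toReal_pos (zero_lt_one.trans_le hp).ne' hpt
    have hq1 : 1 ≤ p.toReal := by
      simpa using (ENNReal.toReal_le_toReal ENNReal.one_ne_top hpt).2 hp
    rw [PiLp.norm_eq_sum hq, PiLp.norm_eq_sum hq]
    have key : ∀ i, |r i| ^ p.toReal ≤ ∑ j, P i j * |s j| ^ p.toReal := by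
      intro i
      have hnn : 0 ≤ ∑ j, P i j * |s j| ^ p.toReal :=
        Finset.sum_nonneg fun j _ => mul_nonneg (hP i j) (by positivity)
      -- Weighted Hölder inequality; the factor made of the total weight is at most 1 because the
      -- row sum is.
      have h1 := Real.inner_le_weight_mul_Lp_of_nonneg Finset.univ hq1 (P i) (fun j => |s j|)
        (hP i) (fun j => abs_nonneg _)
      have h2 : (∑ j, P i j) ^ (1 - p.toReal⁻¹) ≤ 1 :=
        Real.rpow_le_one (Finset.sum_nonneg fun j _ => hP i j) (hrow i)
          (sub_nonneg.2 (inv_le_one_of_one_le₀ hq1))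
      have h3 : |r i| ≤ (∑ j, P i j * |s j| ^ p.toReal) ^ p.toReal⁻¹ :=
        ((hr i).trans h1).trans (mul_le_of_le_one_left (by positivity) h2)
      calc |r i| ^ p.toReal ≤ ((∑ j, P i j * |s j| ^ p.toReal) ^ p.toReal⁻¹) ^ p.toReal := by
            gcongr
        _ = _ := Real.rpow_inv_rpow hnn hq.ne'
    have hsum : ∑ i, |r i| ^ p.toReal ≤ ∑ j, |s j| ^ p.toReal := by
      calc ∑ i, |r i| ^ p.toReal ≤ ∑ i, ∑ j, P i j * |s j| ^ p.toReal :=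
            Finset.sum_le_sum fun i _ => key i
        _ = ∑ j, (∑ i, P i j) * |s j| ^ p.toReal := by
            rw [Finset.sum_comm]
            simp_rw [Finset.sum_mul]
        _ ≤ ∑ j, 1 * |s j| ^ p.toReal := by
            gcongr with j
            exact hcol j
        _ = _ := by simp
    simp only [Real.norm_eq_abs]
    gcongr

/-! ### Singular values and Bessel families -/

section SVD

variable {E F : Type*} [NormedAddCommGroup E] [InnerProductSpace ℝ E]
  [NormedAddCommGroup F] [InnerProductSpace ℝ F]

/-- A family of vectors of norm at most one that satisfies Bessel's inequality. -/
def IsBessel {ι : Type*} [Fintype ι] (a : ι → E) : Prop :=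
  (∀ i, ‖a i‖ ≤ 1) ∧ ∀ w, ∑ i, (inner ℝ (a i) w : ℝ) ^ 2 ≤ ‖w‖ ^ 2

/-- Zero vectors contribute nothing to Bessel's inequality. Allowing them spares completing the left
singular vectors to an orthonormal family, which may be impossible when the codomain has smaller
dimension. -/
theorem IsBessel.of_orthonormal_ne_zero {ι : Type*} [Fintype ι] (u : ι → E)
    (h1 : ∀ i, u i ≠ 0 → ‖u i‖ = 1) (h2 : ∀ i j, i ≠ j → (inner ℝ (u i) (u j) : ℝ) = 0) :
    IsBessel u := by
  classical
  refine ⟨fun i => ?_, fun w => ?_⟩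
  · by_cases h : u i = 0
    · simp [h]
    · exact (h1 i h).le
  · have hon : Orthonormal ℝ (fun i : {i // u i ≠ 0} => u i) :=
      ⟨fun i => h1 i i.2, fun i j hij => h2 i j fun h => hij (Subtype.ext h)⟩
    have : Fintype {i // u i ≠ 0} := Fintype.ofFinite _
    have hB : ∑ i : {i // u i ≠ 0}, ‖(inner ℝ (u i) w : ℝ)‖ ^ 2 ≤ ‖w‖ ^ 2 :=
      hon.sum_inner_products_le w
    refine le_trans (le_of_eq ?_) hB
    have e1 : ∑ i, (inner ℝ (u i) w : ℝ) ^ 2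
        = ∑ i with u i ≠ 0, (inner ℝ (u i) w : ℝ) ^ 2 := by
      symm
      apply Finset.sum_subset (Finset.filter_subset _ _)
      intro i _ hi
      have : u i = 0 := by simpa using hi
      simp [this]
    have e2 : ∑ i with u i ≠ 0, (inner ℝ (u i) w : ℝ) ^ 2
        = ∑ i : {i // u i ≠ 0}, (inner ℝ (u i) w : ℝ) ^ 2 :=
      Finset.sum_subtype _ (by simp) _
    rw [e1, e2]
    simp

theorem isBessel_single {ι : Type*} [Fintype ι] [DecidableEq ι] (j : ι) (e : E) (he : ‖e‖ = 1) :
    IsBessel (fun i => if i = j then e else 0) := by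
  refine IsBessel.of_orthonormal_ne_zero _ (fun i hi => ?_) fun i i' hii' => ?_
  · by_cases h : i = j <;> simp_all
  · by_cases h : i = j
    · have : i' ≠ j := fun h' => hii' (h.trans h'.symm)
      simp [this]
    · simp [h]

variable [FiniteDimensional ℝ E] [FiniteDimensional ℝ F]

/-- Singular value decomposition. -/
theorem exists_svd {d : ℕ} (hd : Module.finrank ℝ E = d) (T : E →ₗ[ℝ] F) :
    ∃ (v : OrthonormalBasis (Fin d) ℝ E) (u : Fin d → F), IsBessel u ∧
      (∀ j : Fin d, T (v j) = T.singularValues j • u j) ∧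
      ∀ j : Fin d, T.singularValues j = inner ℝ (u j) (T (v j)) := by
  set v := T.isSymmetric_adjoint_comp_self.eigenvectorBasis hd with hv
  have hinner : ∀ i j, (inner ℝ (T (v i)) (T (v j)) : ℝ)
      = if i = j then T.singularValues j ^ 2 else 0 := by
    intro i j
    rw [← LinearMap.adjoint_inner_right, ← LinearMap.comp_apply, hv,
      LinearMap.IsSymmetric.apply_eigenvectorBasis, ← hv, inner_smul_right,
      T.sq_singularValues_fin hd, orthonormal_iff_ite.1 v.orthonormal i j]
    by_cases h : i = j <;> simp [h]
  have hnorm : ∀ j, ‖T (v j)‖ = T.singularValues j := by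
    intro j
    have := hinner j j
    rw [real_inner_self_eq_norm_sq, if_pos rfl] at this
    exact (sq_eq_sq₀ (norm_nonneg _) (T.singularValues_nonneg _)).1 this
  have hTu : ∀ j : Fin d, T (v j) =
      T.singularValues j • ((T.singularValues j)⁻¹ • T (v j)) := by
    intro j
    by_cases h : T.singularValues j = 0
    · have : T (v j) = 0 := by rw [← norm_eq_zero, hnorm, h]
      simp [this]
    · rw [smul_smul, mul_inv_cancel₀ h, one_smul]
  -- For a vanishing singular value the inverse is 0, so the left vector is 0.
  refine ⟨v, fun j => (T.singularValues j)⁻¹ • T (v j), ?_, hTu, ?_⟩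
  · refine IsBessel.of_orthonormal_ne_zero _ (fun j hj => ?_) fun i j hij => ?_
    · have h : T.singularValues j ≠ 0 := fun h => hj (by simp [h])
      rw [norm_smul, hnorm, norm_inv, Real.norm_of_nonneg (T.singularValues_nonneg _),
        inv_mul_cancel₀ h]
    · rw [inner_smul_left, inner_smul_right, hinner, if_neg hij]
      simp
  · intro j
    rw [inner_smul_left, hinner, if_pos rfl]
    by_cases h : T.singularValues j = 0
    · simp [h]
    · simp only [conj_trivial]
      field_simp

/-- Matrix coefficients along Bessel families are dominated by the singular values. -/
theorem lp_norm_inner_le_singularValues {d : ℕ} (hd : Module.finrank ℝ E = d) (T : E →ₗ[ℝ] F)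
    (p : ℝ≥0∞) (hp : 1 ≤ p) (a : Fin d → F) (b : Fin d → E) (ha : IsBessel a)
    (hb : IsBessel b) :
    ‖(WithLp.toLp p (fun i => (inner ℝ (a i) (T (b i)) : ℝ)) : PiLp p fun _ : Fin d => ℝ)‖ ≤
      ‖(WithLp.toLp p (fun j : Fin d => T.singularValues j) : PiLp p fun _ : Fin d => ℝ)‖ := by
  obtain ⟨v, u, hu, hTv, -⟩ := exists_svd hd T
  have hvB : IsBessel v := IsBessel.of_orthonormal_ne_zero _ (fun i _ => v.orthonormal.1 i)
    fun i j hij => v.orthonormal.2 hij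
  -- By AM-GM the products of coefficients are averages of squares, so Bessel bounds both the row
  -- and the column sums by 1.
  have amgm : ∀ s t : ℝ, |s| * |t| ≤ (s ^ 2 + t ^ 2) / 2 := by
    intro s t
    nlinarith [sq_nonneg (|s| - |t|), sq_abs s, sq_abs t]
  have sq1 : ∀ {z : ℝ}, 0 ≤ z → z ≤ 1 → z ^ 2 ≤ 1 := fun h0 h1 => pow_le_one₀ h0 h1
  refine lp_norm_le_of_substochastic p hp
    (fun i j => |(inner ℝ (v j) (b i) : ℝ)| * |(inner ℝ (u j) (a i) : ℝ)|)
    (fun i j => by positivity) (fun i => ?_) (fun j => ?_) _ _ (fun i => ?_)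
  · calc _ ≤ ∑ j, ((inner ℝ (v j) (b i) : ℝ) ^ 2 + (inner ℝ (u j) (a i) : ℝ) ^ 2) / 2 :=
          Finset.sum_le_sum fun j _ => amgm _ _
      _ = (∑ j, (inner ℝ (v j) (b i) : ℝ) ^ 2 + ∑ j, (inner ℝ (u j) (a i) : ℝ) ^ 2) / 2 := by
          rw [← Finset.sum_div, Finset.sum_add_distrib]
      _ ≤ 1 := by
          linarith [hvB.2 (b i), hu.2 (a i), sq1 (norm_nonneg _) (hb.1 i),
            sq1 (norm_nonneg _) (ha.1 i)]
  · calc _ ≤ ∑ i, ((inner ℝ (b i) (v j) : ℝ) ^ 2 + (inner ℝ (a i) (u j) : ℝ) ^ 2) / 2 := by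
          refine Finset.sum_le_sum fun i _ => ?_
          rw [real_inner_comm (v j), real_inner_comm (u j)]
          exact amgm _ _
      _ = (∑ i, (inner ℝ (b i) (v j) : ℝ) ^ 2 + ∑ i, (inner ℝ (a i) (u j) : ℝ) ^ 2) / 2 := by
          rw [← Finset.sum_div, Finset.sum_add_distrib]
      _ ≤ 1 := by
          linarith [hb.2 (v j), ha.2 (u j), sq1 (norm_nonneg _) (hvB.1 j),
            sq1 (norm_nonneg _) (hu.1 j)]
  · have e : (inner ℝ (a i) (T (b i)) : ℝ) =
        ∑ j, inner ℝ (v j) (b i) * (T.singularValues j * inner ℝ (u j) (a i)) := by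
      conv_lhs => rw [← v.sum_repr' (b i)]
      simp only [map_sum, map_smul, inner_sum, inner_smul_right, hTv]
      refine Finset.sum_congr rfl fun j _ => ?_
      rw [real_inner_comm (a i) (u j)]
    rw [e]
    refine (Finset.abs_sum_le_sum_abs _ _).trans (le_of_eq (Finset.sum_congr rfl fun j _ => ?_))
    rw [abs_mul, abs_mul]
    ring

end SVD

/-! ### The admissible norms -/

/-- The properties of the entry-wise and Schatten norms that the analysis depends on. -/
structure IsEntryDominatingNorm {k d : ℕ} (N : Matrix (Fin k) (Fin d) ℝ → ℝ) : Prop where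
  add_le : ∀ A B, N (A + B) ≤ N A + N B
  smul_le : ∀ (r : ℝ) A, N (r • A) ≤ |r| * N A
  nonneg : ∀ A, 0 ≤ N A
  entry_le : ∀ A i j, |A i j| ≤ N A

theorem isEntryDominatingNorm_entrywise {k d : ℕ} (p : ℝ≥0∞) (hp : 1 ≤ p) :
    IsEntryDominatingNorm (entrywiseNorm p : Matrix (Fin k) (Fin d) ℝ → ℝ) := by
  have : Fact (1 ≤ p) := ⟨hp⟩
  refine ⟨fun A B => ?_, fun r A => ?_, fun A => norm_nonneg _, fun A i j => ?_⟩
  · exact norm_add_le (WithLp.toLp p (fun q : Fin k × Fin d => A q.1 q.2) :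
      PiLp p fun _ : Fin k × Fin d => ℝ) (WithLp.toLp p (fun q => B q.1 q.2))
  · exact (norm_smul r (WithLp.toLp p (fun q : Fin k × Fin d => A q.1 q.2) :
      PiLp p fun _ : Fin k × Fin d => ℝ)).le
  · exact PiLp.norm_apply_le (WithLp.toLp p (fun q : Fin k × Fin d => A q.1 q.2) :
      PiLp p fun _ : Fin k × Fin d => ℝ) (i, j)

/-- The norm is the ℓ_p norm of the coefficients along the matrix's own singular frames, and it
dominates the coefficients along any Bessel frames. For the triangle inequality, the frames of A + B
are used for A and for B separately. -/
theorem isEntryDominatingNorm_schatten {k d : ℕ} (p : ℝ≥0∞) (hp : 1 ≤ p) :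
    IsEntryDominatingNorm (schattenNorm p : Matrix (Fin k) (Fin d) ℝ → ℝ) := by
  have : Fact (1 ≤ p) := ⟨hp⟩
  have hd : Module.finrank ℝ (EuclideanSpace ℝ (Fin d)) = d := finrank_euclideanSpace_fin
  have basisB : ∀ v : OrthonormalBasis (Fin d) ℝ (EuclideanSpace ℝ (Fin d)), IsBessel v :=
    fun v => IsBessel.of_orthonormal_ne_zero _ (fun i _ => v.orthonormal.1 i)
      fun i j hij => v.orthonormal.2 hij
  refine ⟨fun A B => ?_, fun r A => ?_, fun A => norm_nonneg _, fun A i j => ?_⟩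
  · obtain ⟨v, u, hu, -, hs⟩ := exists_svd hd (Matrix.toEuclideanLin (A + B))
    have h1 := lp_norm_inner_le_singularValues hd (Matrix.toEuclideanLin A) p hp u v hu (basisB v)
    have h2 := lp_norm_inner_le_singularValues hd (Matrix.toEuclideanLin B) p hp u v hu (basisB v)
    refine le_trans (le_of_eq ?_) ((norm_add_le _ _).trans (add_le_add h1 h2))
    rw [schattenNorm, ← WithLp.toLp_add]
    congr 2
    funext j
    rw [hs, map_add, LinearMap.add_apply, inner_add_right]
    rfl
  · obtain ⟨v, u, hu, -, hs⟩ := exists_svd hd (Matrix.toEuclideanLin (r • A))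
    have h1 := lp_norm_inner_le_singularValues hd (Matrix.toEuclideanLin A) p hp u v hu (basisB v)
    refine le_trans (le_of_eq ?_) (mul_le_mul_of_nonneg_left h1 (abs_nonneg r))
    rw [schattenNorm, ← Real.norm_eq_abs, ← norm_smul, ← WithLp.toLp_smul]
    congr 2
    funext j
    rw [hs, map_smul, LinearMap.smul_apply, inner_smul_right]
    rfl
  · have hk1 : ‖EuclideanSpace.single i (1 : ℝ)‖ = 1 := by simp
    have hd1 : ‖EuclideanSpace.single j (1 : ℝ)‖ = 1 := by simp
    -- Both families are zero except at index j, so the only nonzero coefficient is the entry A i j.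
    have h1 := lp_norm_inner_le_singularValues hd (Matrix.toEuclideanLin A) p hp _ _
      (isBessel_single j _ hk1) (isBessel_single j _ hd1)
    refine le_trans (le_trans (le_of_eq ?_) (PiLp.norm_apply_le _ j)) h1
    simp [Matrix.toLpLin_apply, EuclideanSpace.inner_single_left]

theorem IsEntrywiseOrSchatten.isEntryDominatingNorm {k d : ℕ}
    {N : Matrix (Fin k) (Fin d) ℝ → ℝ} (h : IsEntrywiseOrSchatten N) :
    IsEntryDominatingNorm N := by
  obtain ⟨p, hp, rfl | rfl⟩ := h
  · exact isEntryDominatingNorm_entrywise p hp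
  · exact isEntryDominatingNorm_schatten p hp

end VRSteepest

namespace VRSteepest

/-! ### Softmax and cross-entropy of a single sample -/

section Softmax

variable {k : ℕ}

theorem sum_exp_pos (v : Fin k → ℝ) (y : Fin k) : 0 < ∑ j, Real.exp (v j) :=
  Finset.sum_pos (fun _ _ => Real.exp_pos _) ⟨y, Finset.mem_univ y⟩

theorem softmax_pos (v : Fin k → ℝ) (c : Fin k) : 0 < softmax v c :=
  div_pos (Real.exp_pos _) (sum_exp_pos v c)

theorem sum_softmax (v : Fin k → ℝ) (y : Fin k) : ∑ c, softmax v c = 1 := by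
  simp only [softmax]
  rw [← Finset.sum_div, div_self (sum_exp_pos v y).ne']

theorem one_sub_softmax (v : Fin k → ℝ) (y : Fin k) :
    1 - softmax v y = ∑ c ∈ Finset.univ.erase y, softmax v c := by
  rw [← sum_softmax v y, ← Finset.add_sum_erase _ _ (Finset.mem_univ y)]
  ring

theorem one_sub_softmax_pos (hk : 2 ≤ k) (v : Fin k → ℝ) (y : Fin k) :
    0 < 1 - softmax v y := by
  rw [one_sub_softmax]
  refine Finset.sum_pos (fun c _ => softmax_pos v c) ?_
  have : Nontrivial (Fin k) := Fin.nontrivial_iff_two_le.2 hk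
  obtain ⟨c, hc⟩ := exists_ne y
  exact ⟨c, by simp [hc]⟩

theorem one_sub_softmax_nonneg (v : Fin k → ℝ) (y : Fin k) : 0 ≤ 1 - softmax v y := by
  rw [one_sub_softmax]
  exact Finset.sum_nonneg fun c _ => (softmax_pos v c).le

/-- Numerator and denominator each change by a factor of at most e^δ. Only a multiplicative bound of
this kind yields errors relative to the misclassification probability. -/
theorem softmax_le_of_abs_sub_le {v w : Fin k → ℝ} {δ : ℝ} (h : ∀ j, |w j - v j| ≤ δ)
    (c : Fin k) : softmax w c ≤ Real.exp (2 * δ) * softmax v c := by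
  have h1 : Real.exp (w c) ≤ Real.exp δ * Real.exp (v c) := by
    rw [← Real.exp_add]
    exact Real.exp_le_exp.2 (by linarith [(abs_le.1 (h c)).2])
  have h2 : ∑ j, Real.exp (v j) ≤ Real.exp δ * ∑ j, Real.exp (w j) := by
    rw [Finset.mul_sum]
    refine Finset.sum_le_sum fun j _ => ?_
    rw [← Real.exp_add]
    exact Real.exp_le_exp.2 (by linarith [(abs_le.1 (h j)).1])
  have hv := sum_exp_pos v c
  have hw := sum_exp_pos w c
  simp only [softmax]
  rw [← mul_div_assoc, div_le_div_iff₀ hw hv]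
  calc Real.exp (w c) * ∑ j, Real.exp (v j)
      ≤ (Real.exp δ * Real.exp (v c)) * (Real.exp δ * ∑ j, Real.exp (w j)) := by gcongr
    _ = Real.exp (2 * δ) * Real.exp (v c) * ∑ j, Real.exp (w j) := by
        rw [two_mul, Real.exp_add]
        ring

theorem one_sub_softmax_le_of_abs_sub_le {v w : Fin k → ℝ} {δ : ℝ}
    (h : ∀ j, |w j - v j| ≤ δ) (y : Fin k) :
    1 - softmax w y ≤ Real.exp (2 * δ) * (1 - softmax v y) := by
  rw [one_sub_softmax, one_sub_softmax, Finset.mul_sum]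
  exact Finset.sum_le_sum fun c _ => softmax_le_of_abs_sub_le h c

theorem abs_softmax_sub_le {v w : Fin k → ℝ} {δ : ℝ} (h : ∀ j, |w j - v j| ≤ δ)
    (c : Fin k) : |softmax w c - softmax v c| ≤ (Real.exp (2 * δ) - 1) * softmax v c := by
  have h1 := softmax_le_of_abs_sub_le h c
  have h2 := softmax_le_of_abs_sub_le (v := w) (w := v) (δ := δ)
    (fun j => by rw [abs_sub_comm]; exact h j) c
  have hδ : 0 ≤ δ := (abs_nonneg _).trans (h c)
  have he : 1 ≤ Real.exp (2 * δ) := Real.one_le_exp (by linarith)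
  have hv := softmax_pos v c
  have hw := softmax_pos w c
  rw [abs_le]
  constructor
  · by_cases hle : softmax v c ≤ softmax w c
    · nlinarith
    · nlinarith
  · linarith

/-- The probabilities sum to one, so the correct label moves by no more than all the wrong labels
together. Hence the factor is 1 − softmax at y, which is small for well-classified samples, at the
price of a factor 2. -/
theorem sum_abs_softmax_sub_le {v w : Fin k → ℝ} {δ : ℝ} (h : ∀ j, |w j - v j| ≤ δ)
    (y : Fin k) :
    ∑ c, |softmax w c - softmax v c| ≤ 2 * (Real.exp (2 * δ) - 1) * (1 - softmax v y) := by
  have h1 : ∑ c ∈ Finset.univ.erase y, |softmax w c - softmax v c| ≤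
      (Real.exp (2 * δ) - 1) * (1 - softmax v y) := by
    rw [one_sub_softmax, Finset.mul_sum]
    exact Finset.sum_le_sum fun c _ => abs_softmax_sub_le h c
  have h2 : |softmax w y - softmax v y| ≤
      ∑ c ∈ Finset.univ.erase y, |softmax w c - softmax v c| := by
    have : softmax w y - softmax v y =
        -∑ c ∈ Finset.univ.erase y, (softmax w c - softmax v c) := by
      rw [Finset.sum_sub_distrib, ← one_sub_softmax, ← one_sub_softmax]
      ring
    rw [this, abs_neg]
    exact Finset.abs_sum_le_sum_abs _ _
  rw [← Finset.add_sum_erase _ _ (Finset.mem_univ y)]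
  linarith

theorem exp_neg_crossEntropy (v : Fin k → ℝ) (y : Fin k) :
    Real.exp (-crossEntropy v y) = softmax v y := by
  rw [crossEntropy, neg_neg, Real.exp_log (softmax_pos v y)]

theorem exp_crossEntropy (v : Fin k → ℝ) (y : Fin k) :
    Real.exp (crossEntropy v y) = ∑ j, Real.exp (v j - v y) := by
  rw [crossEntropy, Real.exp_neg, Real.exp_log (softmax_pos v y), softmax, inv_div,
    Finset.sum_div]
  simp_rw [Real.exp_sub]

theorem crossEntropy_eq (v : Fin k → ℝ) (y : Fin k) :
    crossEntropy v y = Real.log (∑ j, Real.exp (v j)) - v y := by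
  rw [crossEntropy, softmax, Real.log_div (Real.exp_pos _).ne' (sum_exp_pos v y).ne',
    Real.log_exp]
  ring

theorem crossEntropy_nonneg (v : Fin k → ℝ) (y : Fin k) : 0 ≤ crossEntropy v y := by
  rw [crossEntropy, neg_nonneg]
  exact Real.log_nonpos (softmax_pos v y).le (by linarith [one_sub_softmax_nonneg v y])

/-- The exponential of the loss is 1 plus the sum of exp(−margin) over all wrong classes; one
summand is kept. -/
theorem exp_neg_margin_le (v : Fin k → ℝ) {y c : Fin k} (hc : c ≠ y) :
    Real.exp (-(v y - v c)) ≤ Real.exp (crossEntropy v y) - 1 := by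
  rw [exp_crossEntropy, ← Finset.add_sum_erase _ _ (Finset.mem_univ y), sub_self, Real.exp_zero,
    neg_sub]
  have : Real.exp (v c - v y) ≤ ∑ j ∈ Finset.univ.erase y, Real.exp (v j - v y) :=
    Finset.single_le_sum (f := fun j => Real.exp (v j - v y))
      (fun j _ => (Real.exp_pos _).le) (by simp [hc])
  linarith

theorem crossEntropy_le_add {v w : Fin k → ℝ} {δ : ℝ} (h : ∀ j, |w j - v j| ≤ δ)
    (y : Fin k) : crossEntropy w y ≤ crossEntropy v y + 2 * δ := by
  have h2 := softmax_le_of_abs_sub_le (v := w) (w := v) (δ := δ)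
    (fun j => by rw [abs_sub_comm]; exact h j) y
  rw [← exp_neg_crossEntropy, ← exp_neg_crossEntropy, ← Real.exp_add, Real.exp_le_exp] at h2
  linarith

/-- The gradient of the cross-entropy with respect to the logits. -/
noncomputable def logitGrad (v : Fin k → ℝ) (y c : Fin k) : ℝ :=
  softmax v c - if c = y then 1 else 0

theorem sum_logitGrad_mul (v w : Fin k → ℝ) (y : Fin k) :
    ∑ c, logitGrad v y c * w c = ∑ c, softmax v c * (w c - w y) := by
  simp only [logitGrad, sub_mul, mul_sub, Finset.sum_sub_distrib, ite_mul, one_mul, zero_mul,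
    Finset.sum_ite_eq', Finset.mem_univ, if_true]
  rw [← Finset.sum_mul, sum_softmax v y, one_mul]

theorem sum_abs_logitGrad (v : Fin k → ℝ) (y : Fin k) :
    ∑ c, |logitGrad v y c| = 2 * (1 - softmax v y) := by
  have h1 : |logitGrad v y y| = 1 - softmax v y := by
    rw [logitGrad, if_pos rfl, abs_sub_comm, abs_of_nonneg (one_sub_softmax_nonneg v y)]
  have h2 : ∑ c ∈ Finset.univ.erase y, |logitGrad v y c| = 1 - softmax v y := by
    rw [one_sub_softmax]
    refine Finset.sum_congr rfl fun c hc => ?_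
    rw [logitGrad, if_neg (Finset.ne_of_mem_erase hc), sub_zero, abs_of_pos (softmax_pos v c)]
  rw [← Finset.add_sum_erase _ _ (Finset.mem_univ y), h1, h2]
  ring

theorem sum_abs_logitGrad_sub_le {v w : Fin k → ℝ} {δ : ℝ} (h : ∀ j, |w j - v j| ≤ δ)
    (y : Fin k) :
    ∑ c, |logitGrad w y c - logitGrad v y c| ≤
      2 * (Real.exp (2 * δ) - 1) * (1 - softmax v y) := by
  simpa [logitGrad] using sum_abs_softmax_sub_le h y

/-- The directional derivative averages the negative margins of the direction with the softmax
weights of the wrong classes, whose total mass is 1 − softmax at y. -/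
theorem sum_logitGrad_mul_le_neg_margin (v w : Fin k → ℝ) (y : Fin k) {g : ℝ}
    (hg : ∀ c, c ≠ y → g ≤ w y - w c) :
    ∑ c, logitGrad v y c * w c ≤ -(g * (1 - softmax v y)) := by
  rw [sum_logitGrad_mul, ← Finset.add_sum_erase _ _ (Finset.mem_univ y), sub_self, mul_zero,
    zero_add, one_sub_softmax, Finset.mul_sum, ← Finset.sum_neg_distrib]
  refine Finset.sum_le_sum fun c hc => ?_
  nlinarith [softmax_pos v c, hg c (Finset.ne_of_mem_erase hc)]

/-- Second-order upper bound for the cross-entropy. -/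
theorem crossEntropy_add_le (v w : Fin k → ℝ) (y : Fin k) {h : ℝ} (hw : ∀ j, |w j| ≤ h)
    (hh : 2 * h ≤ 1) :
    crossEntropy (v + w) y ≤ crossEntropy v y + ∑ c, logitGrad v y c * w c
      + 4 * h ^ 2 * (1 - softmax v y) := by
  have hS := sum_exp_pos v y
  have hS' := sum_exp_pos (v + w) y
  have hratio : crossEntropy (v + w) y - crossEntropy v y
      = Real.log (∑ c, softmax v c * Real.exp (w c - w y)) := by
    have : ∑ c, softmax v c * Real.exp (w c - w y)
        = (∑ j, Real.exp ((v + w) j)) / (∑ j, Real.exp (v j)) * Real.exp (-w y) := by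
      rw [Finset.sum_div, Finset.sum_mul]
      refine Finset.sum_congr rfl fun c _ => ?_
      rw [softmax, Pi.add_apply, Real.exp_add, sub_eq_add_neg, Real.exp_add]
      ring
    rw [this, Real.log_mul (div_pos hS' hS).ne' (Real.exp_pos _).ne', Real.log_exp,
      Real.log_div hS'.ne' hS.ne', crossEntropy_eq, crossEntropy_eq, Pi.add_apply]
    ring
  have hpos : 0 < ∑ c, softmax v c * Real.exp (w c - w y) :=
    Finset.sum_pos (fun c _ => mul_pos (softmax_pos v c) (Real.exp_pos _))
      ⟨y, Finset.mem_univ y⟩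
  -- After log z ≤ z − 1 the term of the correct label cancels, so both the linear and the quadratic
  -- part carry only the mass of the wrong labels.
  have hlog := Real.log_le_sub_one_of_pos hpos
  have hsum : ∑ c, softmax v c * Real.exp (w c - w y) - 1
      = ∑ c ∈ Finset.univ.erase y, softmax v c * (Real.exp (w c - w y) - 1) := by
    simp only [mul_sub, Finset.sum_sub_distrib, mul_one]
    rw [← one_sub_softmax, ← Finset.add_sum_erase _ _ (Finset.mem_univ y), sub_self,
      Real.exp_zero]
    ring
  have hlin : ∑ c, logitGrad v y c * w c
      = ∑ c ∈ Finset.univ.erase y, softmax v c * (w c - w y) := by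
    rw [sum_logitGrad_mul, ← Finset.add_sum_erase _ _ (Finset.mem_univ y), sub_self, mul_zero,
      zero_add]
  have hterm : ∑ c ∈ Finset.univ.erase y, softmax v c * (Real.exp (w c - w y) - 1)
      ≤ ∑ c ∈ Finset.univ.erase y,
        (softmax v c * (w c - w y) + 4 * h ^ 2 * softmax v c) := by
    refine Finset.sum_le_sum fun c _ => ?_
    have hz : |w c - w y| ≤ 2 * h := by
      have := abs_sub (w c) (w y)
      linarith [hw c, hw y]
    have h1 := (abs_le.1 (Real.abs_exp_sub_one_sub_id_le (hz.trans hh))).2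
    have h2 : (w c - w y) ^ 2 ≤ 4 * h ^ 2 := by
      have := sq_le_sq' (abs_le.1 hz).1 (abs_le.1 hz).2
      linarith
    nlinarith [softmax_pos v c]
  rw [Finset.sum_add_distrib, ← Finset.mul_sum, ← one_sub_softmax, ← hlin, ← hsum] at hterm
  linarith

theorem hasDerivAt_crossEntropy (v w : Fin k → ℝ) (y : Fin k) :
    HasDerivAt (fun s : ℝ => crossEntropy (v + s • w) y) (∑ c, logitGrad v y c * w c) 0 := by
  have hS := sum_exp_pos v y
  have h1 : ∀ c, HasDerivAt (fun s : ℝ => v c + s * w c) (w c) 0 := fun c => by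
    simpa using ((hasDerivAt_id (0 : ℝ)).mul_const (w c)).const_add (v c)
  have h2 : HasDerivAt (fun s : ℝ => ∑ c, Real.exp (v c + s * w c))
      (∑ c, Real.exp (v c) * w c) 0 := by
    have := HasDerivAt.fun_sum (u := Finset.univ) fun c _ => (h1 c).exp
    simpa using this
  have h3 := (h2.log (by simpa using hS.ne')).sub (h1 y)
  have e : (fun s : ℝ => crossEntropy (v + s • w) y)
      = fun s => Real.log (∑ c, Real.exp (v c + s * w c)) - (v y + s * w y) := by
    funext s
    simp [crossEntropy_eq]
  rw [e]
  refine h3.congr_deriv ?_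
  simp only [zero_mul, add_zero, logitGrad, sub_mul, ite_mul, one_mul, Finset.sum_sub_distrib,
    Finset.sum_ite_eq', Finset.mem_univ, if_true]
  rw [Finset.sum_div]
  congr 1
  refine Finset.sum_congr rfl fun c _ => ?_
  rw [softmax]
  ring

end Softmax

/-! ### Loss and gradient relative to the misclassification probability -/

section Gradient

variable {n k d : ℕ}

/-- Sum of the absolute values of the entries. -/
def entrySum (A : Matrix (Fin k) (Fin d) ℝ) : ℝ := ∑ c, ∑ j, |A c j|

theorem entrySum_nonneg (A : Matrix (Fin k) (Fin d) ℝ) : 0 ≤ entrySum A :=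
  Finset.sum_nonneg fun _ _ => Finset.sum_nonneg fun _ _ => abs_nonneg _

theorem entrySum_add_le (A A' : Matrix (Fin k) (Fin d) ℝ) :
    entrySum (A + A') ≤ entrySum A + entrySum A' := by
  simp only [entrySum, ← Finset.sum_add_distrib]
  exact Finset.sum_le_sum fun c _ => Finset.sum_le_sum fun j _ => abs_add_le _ _

theorem entrySum_neg (A : Matrix (Fin k) (Fin d) ℝ) : entrySum (-A) = entrySum A := by
  simp [entrySum]

theorem entrySum_smul (r : ℝ) (A : Matrix (Fin k) (Fin d) ℝ) :
    entrySum (r • A) = |r| * entrySum A := by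
  simp [entrySum, abs_mul, Finset.mul_sum]

theorem entrySum_sum_le {ι : Type*} (s : Finset ι) (A : ι → Matrix (Fin k) (Fin d) ℝ) :
    entrySum (∑ i ∈ s, A i) ≤ ∑ i ∈ s, entrySum (A i) :=
  Finset.le_sum_of_subadditive _ (by simp [entrySum]) entrySum_add_le _ _

theorem entrySum_vecMulVec (g : Fin k → ℝ) (u : Fin d → ℝ) :
    entrySum (Matrix.vecMulVec g u) = (∑ c, |g c|) * ∑ j, |u j| := by
  simp [entrySum, Matrix.vecMulVec_apply, abs_mul, Finset.sum_mul_sum]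

theorem trace_transpose_mul (A E : Matrix (Fin k) (Fin d) ℝ) :
    (Aᵀ * E).trace = ∑ c, ∑ j, A c j * E c j := by
  simp only [Matrix.trace, Matrix.diag, Matrix.mul_apply, Matrix.transpose_apply]
  exact Finset.sum_comm

/-- Duality of the ℓ₁ and ℓ_∞ norms of the entries; it applies to the unit ball of every admissible
norm. -/
theorem abs_trace_le_entrySum (A E : Matrix (Fin k) (Fin d) ℝ) (hE : ∀ c j, |E c j| ≤ 1) :
    |(Aᵀ * E).trace| ≤ entrySum A := by
  rw [trace_transpose_mul]
  refine (Finset.abs_sum_le_sum_abs _ _).trans (Finset.sum_le_sum fun c _ => ?_)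
  refine (Finset.abs_sum_le_sum_abs _ _).trans (Finset.sum_le_sum fun j _ => ?_)
  rw [abs_mul]
  exact mul_le_of_le_one_right (abs_nonneg _) (hE c j)

theorem abs_mulVec_le {A : Matrix (Fin k) (Fin d) ℝ} {u : Fin d → ℝ} {r R : ℝ}
    (hr : 0 ≤ r) (hA : ∀ c j, |A c j| ≤ r) (hu : ∑ j, |u j| ≤ R) (c : Fin k) :
    |(A *ᵥ u) c| ≤ r * R := by
  simp only [Matrix.mulVec, dotProduct]
  calc |∑ j, A c j * u j| ≤ ∑ j, |A c j * u j| := Finset.abs_sum_le_sum_abs _ _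
    _ ≤ ∑ j, r * |u j| := by
        refine Finset.sum_le_sum fun j _ => ?_
        rw [abs_mul]
        exact mul_le_mul_of_nonneg_right (hA c j) (abs_nonneg _)
    _ = r * ∑ j, |u j| := by rw [Finset.mul_sum]
    _ ≤ r * R := by gcongr

variable (x : Fin n → Fin d → ℝ) (y : Fin n → Fin k)

/-- Gradient of the loss of a single sample. -/
noncomputable def sampleGrad (i : Fin n) (W : Matrix (Fin k) (Fin d) ℝ) :
    Matrix (Fin k) (Fin d) ℝ :=
  Matrix.vecMulVec (logitGrad (W *ᵥ x i) (y i)) (x i)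

/-- Misclassification probability of a single sample. -/
noncomputable def sampleMiss (i : Fin n) (W : Matrix (Fin k) (Fin d) ℝ) : ℝ :=
  1 - softmax (W *ᵥ x i) (y i)

/-- Average misclassification probability. -/
noncomputable def avgMiss (W : Matrix (Fin k) (Fin d) ℝ) : ℝ :=
  (n : ℝ)⁻¹ * ∑ i, sampleMiss x y i W

theorem matGrad_batchLoss (B : Finset (Fin n)) (W : Matrix (Fin k) (Fin d) ℝ) :
    matGrad (batchLoss x y B) W = (B.card : ℝ)⁻¹ • ∑ i ∈ B, sampleGrad x y i W := by
  ext c j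
  have h : ∀ i, HasDerivAt
      (fun s : ℝ => crossEntropy ((W + s • Matrix.single c j (1 : ℝ)) *ᵥ x i) (y i))
      (sampleGrad x y i W c j) 0 := by
    intro i
    have h1 := hasDerivAt_crossEntropy (W *ᵥ x i) (Matrix.single c j (1 : ℝ) *ᵥ x i) (y i)
    have e : ∑ c', logitGrad (W *ᵥ x i) (y i) c' * (Matrix.single c j (1 : ℝ) *ᵥ x i) c'
        = sampleGrad x y i W c j := by
      rw [sampleGrad, Matrix.vecMulVec_apply, Finset.sum_eq_single c]
      · simp [Matrix.mulVec, dotProduct, Matrix.single_apply]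
      · intro b _ hb
        simp [Matrix.mulVec, dotProduct, hb.symm]
      · simp
    rw [e] at h1
    simpa only [Matrix.add_mulVec, Matrix.smul_mulVec] using h1
  have h2 := (HasDerivAt.fun_sum (u := B) fun i _ => h i).const_mul ((B.card : ℝ)⁻¹)
  rw [matGrad, Matrix.of_apply, Matrix.smul_apply, Matrix.sum_apply, smul_eq_mul]
  exact h2.deriv

theorem trace_sampleGrad (i : Fin n) (W E : Matrix (Fin k) (Fin d) ℝ) :
    ((sampleGrad x y i W)ᵀ * E).trace
      = ∑ c, logitGrad (W *ᵥ x i) (y i) c * (E *ᵥ x i) c := by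
  rw [trace_transpose_mul]
  refine Finset.sum_congr rfl fun c _ => ?_
  simp only [sampleGrad, Matrix.vecMulVec_apply, Matrix.mulVec, dotProduct, Finset.mul_sum]
  exact Finset.sum_congr rfl fun j _ => by ring

theorem trace_batchGrad (B : Finset (Fin n)) (W E : Matrix (Fin k) (Fin d) ℝ) :
    ((matGrad (batchLoss x y B) W)ᵀ * E).trace
      = (B.card : ℝ)⁻¹ * ∑ i ∈ B, ∑ c, logitGrad (W *ᵥ x i) (y i) c * (E *ᵥ x i) c := by
  rw [matGrad_batchLoss, Matrix.transpose_smul, Matrix.smul_mul, Matrix.trace_smul,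
    Matrix.transpose_sum, Matrix.sum_mul, Matrix.trace_sum, smul_eq_mul]
  simp_rw [trace_sampleGrad]

variable {x y}

theorem abs_logits_sub_le {R r : ℝ} (hx : ∀ i, ∑ j, |x i j| ≤ R) (hr : 0 ≤ r)
    {W W' : Matrix (Fin k) (Fin d) ℝ} (hW : ∀ c j, |(W' - W) c j| ≤ r) (i : Fin n) (c : Fin k) :
    |(W' *ᵥ x i) c - (W *ᵥ x i) c| ≤ r * R := by
  rw [← Pi.sub_apply, ← Matrix.sub_mulVec]
  exact abs_mulVec_le hr hW (hx i) c

theorem sampleMiss_nonneg (i : Fin n) (W : Matrix (Fin k) (Fin d) ℝ) :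
    0 ≤ sampleMiss x y i W :=
  one_sub_softmax_nonneg _ _

theorem avgMiss_pos (hn : 0 < n) (hk : 2 ≤ k) (W : Matrix (Fin k) (Fin d) ℝ) :
    0 < avgMiss x y W := by
  refine mul_pos (by positivity) (Finset.sum_pos (fun i _ => one_sub_softmax_pos hk _ _) ?_)
  exact ⟨⟨0, hn⟩, Finset.mem_univ _⟩

theorem avgMiss_le {R r : ℝ} (hx : ∀ i, ∑ j, |x i j| ≤ R) (hr : 0 ≤ r)
    {W W' : Matrix (Fin k) (Fin d) ℝ} (hW : ∀ c j, |(W' - W) c j| ≤ r) :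
    avgMiss x y W' ≤ Real.exp (2 * (r * R)) * avgMiss x y W := by
  rw [avgMiss, avgMiss, mul_left_comm]
  refine mul_le_mul_of_nonneg_left ?_ (by positivity)
  rw [Finset.mul_sum]
  exact Finset.sum_le_sum fun i _ =>
    one_sub_softmax_le_of_abs_sub_le (abs_logits_sub_le hx hr hW i) (y i)

theorem entrySum_fullGrad_le {R : ℝ} (hx : ∀ i, ∑ j, |x i j| ≤ R)
    (W : Matrix (Fin k) (Fin d) ℝ) :
    entrySum (matGrad (fullLoss x y) W) ≤ 2 * R * avgMiss x y W := by
  have : fullLoss x y = batchLoss x y Finset.univ := rfl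
  rw [this, matGrad_batchLoss, entrySum_smul, Finset.card_univ, Fintype.card_fin,
    abs_of_nonneg (by positivity), avgMiss, mul_left_comm]
  refine mul_le_mul_of_nonneg_left ?_ (by positivity)
  rw [Finset.mul_sum]
  refine (entrySum_sum_le _ _).trans (Finset.sum_le_sum fun i _ => ?_)
  rw [sampleGrad, entrySum_vecMulVec, sum_abs_logitGrad, ← sampleMiss]
  nlinarith [hx i, sampleMiss_nonneg (x := x) (y := y) i W]

/-- Change of a mini-batch gradient, relative to the total misclassification. -/
theorem entrySum_batchGrad_sub_le {R r : ℝ} (hR : 0 ≤ R) (hx : ∀ i, ∑ j, |x i j| ≤ R)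
    (hr : 0 ≤ r) {W W' : Matrix (Fin k) (Fin d) ℝ} (hW : ∀ c j, |(W' - W) c j| ≤ r)
    (B : Finset (Fin n)) :
    entrySum (matGrad (batchLoss x y B) W' - matGrad (batchLoss x y B) W)
      ≤ (n / B.card) * (2 * R * (Real.exp (2 * (r * R)) - 1) * avgMiss x y W) := by
  have hE : 0 ≤ Real.exp (2 * (r * R)) - 1 := sub_nonneg.2 (Real.one_le_exp (by positivity))
  rw [matGrad_batchLoss, matGrad_batchLoss, ← smul_sub, ← Finset.sum_sub_distrib, entrySum_smul,
    abs_of_nonneg (by positivity)]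
  -- The sum over the batch is enlarged to the whole training set. This loses the factor n/|B|,
  -- which equals the number m of batches per epoch.
  have h1 : entrySum (∑ i ∈ B, (sampleGrad x y i W' - sampleGrad x y i W))
      ≤ ∑ i, 2 * R * (Real.exp (2 * (r * R)) - 1) * sampleMiss x y i W := by
    refine (entrySum_sum_le _ _).trans ?_
    refine (Finset.sum_le_sum fun i _ => ?_).trans
      (Finset.sum_le_sum_of_subset_of_nonneg (Finset.subset_univ B) fun i _ _ => ?_)
    · rw [sampleGrad, sampleGrad, ← Matrix.sub_vecMulVec, entrySum_vecMulVec]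
      have h2 := sum_abs_logitGrad_sub_le (abs_logits_sub_le hx hr hW i) (y i)
      have h3 : 0 ≤ ∑ j, |x i j| := Finset.sum_nonneg fun _ _ => abs_nonneg _
      have h4 := sampleMiss_nonneg (x := x) (y := y) i W
      simp only [Pi.sub_apply]
      rw [← sampleMiss] at h2
      calc _ ≤ (2 * (Real.exp (2 * (r * R)) - 1) * sampleMiss x y i W) * R := by
            gcongr
            exact hx i
        _ = _ := by ring
    · have := sampleMiss_nonneg (x := x) (y := y) i W
      positivity
  rcases n.eq_zero_or_pos with rfl | hn
  · have : B.card = 0 := by simpa using B.card_le_univ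
    simp [this]
  · calc _ ≤ (B.card : ℝ)⁻¹ * ∑ i, 2 * R * (Real.exp (2 * (r * R)) - 1) * sampleMiss x y i W := by
          gcongr
      _ = _ := by
          rw [← Finset.mul_sum, avgMiss]
          field_simp

/-- Serves for the burn-in period: no descent is guaranteed there, and the loss is only known to
grow at most linearly with the distance travelled. -/
theorem fullLoss_le_add {R r : ℝ} (hn : 0 < n) (hx : ∀ i, ∑ j, |x i j| ≤ R) (hr : 0 ≤ r)
    {W W' : Matrix (Fin k) (Fin d) ℝ} (hW : ∀ c j, |(W' - W) c j| ≤ r) :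
    fullLoss x y W' ≤ fullLoss x y W + 2 * (r * R) := by
  simp only [fullLoss, batchLoss, Finset.card_univ, Fintype.card_fin]
  have h : ∑ i, crossEntropy (W' *ᵥ x i) (y i)
      ≤ ∑ i, (crossEntropy (W *ᵥ x i) (y i) + 2 * (r * R)) :=
    Finset.sum_le_sum fun i _ => crossEntropy_le_add (abs_logits_sub_le hx hr hW i) (y i)
  rw [Finset.sum_add_distrib, Finset.sum_const, Finset.card_univ, Fintype.card_fin,
    nsmul_eq_mul] at h
  calc _ ≤ (n : ℝ)⁻¹ * (∑ i, crossEntropy (W *ᵥ x i) (y i) + n * (2 * (r * R))) := by gcongr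
    _ = _ := by field_simp

theorem fullLoss_add_le {R r : ℝ} (hx : ∀ i, ∑ j, |x i j| ≤ R) (hr : 0 ≤ r)
    (hrR : 2 * (r * R) ≤ 1) (W : Matrix (Fin k) (Fin d) ℝ) {E : Matrix (Fin k) (Fin d) ℝ}
    (hE : ∀ c j, |E c j| ≤ r) :
    fullLoss x y (W + E) ≤ fullLoss x y W + ((matGrad (fullLoss x y) W)ᵀ * E).trace
      + 4 * (r * R) ^ 2 * avgMiss x y W := by
  have : fullLoss x y = batchLoss x y Finset.univ := rfl
  rw [this, trace_batchGrad]
  simp only [batchLoss, Finset.card_univ, Fintype.card_fin, avgMiss, Finset.mul_sum,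
    ← Finset.sum_add_distrib]
  refine Finset.sum_le_sum fun i _ => ?_
  have h := crossEntropy_add_le (W *ᵥ x i) (E *ᵥ x i) (y i)
    (fun c => abs_mulVec_le hr hE (hx i) c) hrR
  rw [← Matrix.add_mulVec, ← sampleMiss] at h
  have h2 := mul_le_mul_of_nonneg_left h (by positivity : (0 : ℝ) ≤ (n : ℝ)⁻¹)
  rw [← Finset.mul_sum]
  linarith

theorem trace_fullGrad_le_neg_margin (W E : Matrix (Fin k) (Fin d) ℝ) {g : ℝ}
    (hg : ∀ i c, c ≠ y i → g ≤ (E *ᵥ x i) (y i) - (E *ᵥ x i) c) :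
    ((matGrad (fullLoss x y) W)ᵀ * E).trace ≤ -(g * avgMiss x y W) := by
  have : fullLoss x y = batchLoss x y Finset.univ := rfl
  rw [this, trace_batchGrad, avgMiss, Finset.card_univ, Fintype.card_fin, mul_left_comm,
    ← mul_neg]
  refine mul_le_mul_of_nonneg_left ?_ (by positivity)
  rw [Finset.mul_sum, ← Finset.sum_neg_distrib]
  exact Finset.sum_le_sum fun i _ => sum_logitGrad_mul_le_neg_margin _ _ _ (hg i)

theorem fullLoss_nonneg (W : Matrix (Fin k) (Fin d) ℝ) : 0 ≤ fullLoss x y W :=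
  mul_nonneg (by positivity) (Finset.sum_nonneg fun _ _ => crossEntropy_nonneg _ _)

theorem mul_fullLoss (hn : 0 < n) (W : Matrix (Fin k) (Fin d) ℝ) :
    n * fullLoss x y W = ∑ i, crossEntropy (W *ᵥ x i) (y i) := by
  simp only [fullLoss, batchLoss, Finset.card_univ, Fintype.card_fin]
  field_simp

/-- The misclassification controls the loss from below. -/
theorem one_sub_exp_neg_le (hn : 0 < n) (W : Matrix (Fin k) (Fin d) ℝ) :
    1 - Real.exp (-(n * fullLoss x y W)) ≤ n * avgMiss x y W := by
  rw [mul_fullLoss hn, avgMiss, ← mul_assoc, mul_inv_cancel₀ (by positivity), one_mul,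
    ← Finset.sum_neg_distrib, Real.exp_sum]
  simp only [exp_neg_crossEntropy]
  -- A union bound: one minus a product of probabilities is at most the sum of the complementary
  -- probabilities.
  have key : ∀ s : Finset (Fin n), 1 - ∏ i ∈ s, softmax (W *ᵥ x i) (y i) ≤
      ∑ i ∈ s, sampleMiss x y i W := by
    intro s
    induction s using Finset.induction_on with
    | empty => simp
    | insert i s hi ih =>
      rw [Finset.prod_insert hi, Finset.sum_insert hi, sampleMiss]
      have h0 := softmax_pos (W *ᵥ x i) (y i)
      have h1 := one_sub_softmax_nonneg (W *ᵥ x i) (y i)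
      have h2 : ∏ i ∈ s, softmax (W *ᵥ x i) (y i) ≤ 1 :=
        Finset.prod_le_one (fun i _ => (softmax_pos _ _).le)
          fun i _ => by linarith [one_sub_softmax_nonneg (W *ᵥ x i) (y i)]
      nlinarith
  exact key _

theorem exp_neg_margin_le_fullLoss (hn : 0 < n) (W : Matrix (Fin k) (Fin d) ℝ) (i : Fin n)
    {c : Fin k} (hc : c ≠ y i) :
    Real.exp (-((W *ᵥ x i) (y i) - (W *ᵥ x i) c)) ≤ Real.exp (n * fullLoss x y W) - 1 := by
  refine (exp_neg_margin_le _ hc).trans ?_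
  rw [mul_fullLoss hn]
  have := Finset.single_le_sum (f := fun i => crossEntropy (W *ᵥ x i) (y i))
    (fun i _ => crossEntropy_nonneg _ _) (Finset.mem_univ i)
  simpa using this

end Gradient

end VRSteepest

namespace VRSteepest

variable {n k d : ℕ}

/-! ### Margins -/

section Margin

variable {x : Fin n → Fin d → ℝ} {y : Fin n → Fin k}

theorem minMargin_le (W : Matrix (Fin k) (Fin d) ℝ) (i : Fin n) (c : Fin k) (hc : c ≠ y i) :
    minMargin x y W ≤ (W *ᵥ x i) (y i) - (W *ᵥ x i) c :=
  ciInf_le (Set.finite_range _).bddBelow (⟨(i, c), hc⟩ : {q : Fin n × Fin k // q.2 ≠ y q.1})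

theorem exists_minMargin_eq (hn : 0 < n) (hk : 2 ≤ k) (W : Matrix (Fin k) (Fin d) ℝ) :
    ∃ i c, c ≠ y i ∧ minMargin x y W = (W *ᵥ x i) (y i) - (W *ᵥ x i) c := by
  have : Nontrivial (Fin k) := Fin.nontrivial_iff_two_le.2 hk
  obtain ⟨c, hc⟩ := exists_ne (y ⟨0, hn⟩)
  have : Nonempty {q : Fin n × Fin k // q.2 ≠ y q.1} := ⟨⟨(⟨0, hn⟩, c), hc⟩⟩
  obtain ⟨⟨⟨i, c⟩, h⟩, he⟩ := exists_eq_ciInf_of_finite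
    (f := fun q : {q : Fin n × Fin k // q.2 ≠ y q.1} =>
      (W *ᵥ x q.1.1) (y q.1.1) - (W *ᵥ x q.1.1) q.1.2)
  exact ⟨i, c, h, he.symm⟩

theorem minMargin_zero (hn : 0 < n) (hk : 2 ≤ k) :
    minMargin x y (0 : Matrix (Fin k) (Fin d) ℝ) = 0 := by
  obtain ⟨i, c, -, h⟩ := exists_minMargin_eq (x := x) (y := y) hn hk 0
  simpa using h

/-- Near-maximizers suffice, so attainment of the supremum is never needed. Positivity of γ excludes
the default value 0 of the supremum of the empty set. -/
theorem exists_lt_minMargin {N : Matrix (Fin k) (Fin d) ℝ → ℝ} {γ g : ℝ}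
    (h : maxMargin N x y = γ) (hγ : 0 < γ) (hg : g < γ) :
    ∃ E, N E ≤ 1 ∧ g < minMargin x y E := by
  have hne : (minMargin x y '' {W | N W ≤ 1}).Nonempty := by
    by_contra hcon
    rw [Set.not_nonempty_iff_eq_empty] at hcon
    rw [maxMargin, hcon, Real.sSup_empty] at h
    exact hγ.ne h
  obtain ⟨_, ⟨E, hE, rfl⟩, hlt⟩ := exists_lt_of_lt_csSup hne (h.symm ▸ hg)
  exact ⟨E, hE, hlt⟩

theorem exp_neg_minMargin_le (hn : 0 < n) (hk : 2 ≤ k) (W : Matrix (Fin k) (Fin d) ℝ) :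
    Real.exp (-minMargin x y W) ≤ Real.exp (n * fullLoss x y W) - 1 := by
  obtain ⟨i, c, hc, h⟩ := exists_minMargin_eq (x := x) (y := y) hn hk W
  rw [h]
  exact exp_neg_margin_le_fullLoss hn W i hc

end Margin

/-! ### Trajectories: displacement, momentum error, descent -/

/-- Cumulative step size. -/
def totalStep (η : ℕ → ℝ) (t : ℕ) : ℝ := ∑ s ∈ Finset.range t, η s

theorem totalStep_succ (η : ℕ → ℝ) (t : ℕ) : totalStep η (t + 1) = totalStep η t + η t :=
  Finset.sum_range_succ _ _

theorem totalStep_mono {η : ℕ → ℝ} (hη : ∀ t, 0 ≤ η t) : Monotone (totalStep η) :=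
  monotone_nat_of_le_succ fun t => by linarith [totalStep_succ η t, hη t]

section Trajectory

variable {N : Matrix (Fin k) (Fin d) ℝ → ℝ} {η : ℕ → ℝ} {W D : ℕ → Matrix (Fin k) (Fin d) ℝ}

theorem norm_iterate_le (hN : IsEntryDominatingNorm N) (hη : ∀ t, 0 ≤ η t)
    (hD : ∀ t, N (D t) ≤ 1) (hW : ∀ t, W (t + 1) = W t - η t • D t) (t : ℕ) :
    N (W t) ≤ N (W 0) + totalStep η t := by
  induction t with
  | zero => simp [totalStep]
  | succ t ih =>
    rw [hW, sub_eq_add_neg, ← neg_smul, totalStep_succ]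
    have h1 := hN.add_le (W t) (-η t • D t)
    have h2 := hN.smul_le (-η t) (D t)
    rw [abs_neg, abs_of_nonneg (hη t)] at h2
    nlinarith [hD t, hη t]

theorem abs_iterate_sub_le (hN : IsEntryDominatingNorm N) (hη : ∀ t, 0 ≤ η t)
    (hD : ∀ t, N (D t) ≤ 1) (hW : ∀ t, W (t + 1) = W t - η t • D t) {s t : ℕ} (hst : s ≤ t)
    (c : Fin k) (j : Fin d) :
    |(W t - W s) c j| ≤ totalStep η t - totalStep η s := by
  induction t, hst using Nat.le_induction with
  | base => simp
  | succ t _ ih =>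
    have e : (W (t + 1) - W s) c j = (W t - W s) c j + -(η t * D t c j) := by
      simp [hW]
      ring
    have h1 := abs_add_le ((W t - W s) c j) (-(η t * D t c j))
    have h2 : |-(η t * D t c j)| ≤ η t := by
      rw [abs_neg, abs_mul, abs_of_nonneg (hη t)]
      exact mul_le_of_le_one_right (hη t) ((hN.entry_le _ _ _).trans (hD t))
    rw [e, totalStep_succ]
    linarith

theorem abs_sub_iterate_le (hN : IsEntryDominatingNorm N) (hη : ∀ t, 0 ≤ η t)
    (hD : ∀ t, N (D t) ≤ 1) (hW : ∀ t, W (t + 1) = W t - η t • D t) {s t : ℕ} (hst : s ≤ t)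
    (c : Fin k) (j : Fin d) :
    |(W s - W t) c j| ≤ totalStep η t - totalStep η s := by
  have := abs_iterate_sub_le hN hη hD hW hst c j
  rwa [Matrix.sub_apply, abs_sub_comm, ← Matrix.sub_apply] at this

variable {x : Fin n → Fin d → ℝ} {y : Fin n → Fin k}

/-- Relative error of the momentum as an estimate of the full gradient. -/
noncomputable def relError (x : Fin n → Fin d → ℝ) (y : Fin n → Fin k)
    (W M : ℕ → Matrix (Fin k) (Fin d) ℝ) (t : ℕ) : ℝ :=
  entrySum (M t - matGrad (fullLoss x y) (W t)) / avgMiss x y (W t)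

theorem entrySum_eq_relError_mul (hn : 0 < n) (hk : 2 ≤ k)
    (M : ℕ → Matrix (Fin k) (Fin d) ℝ) (t : ℕ) :
    entrySum (M t - matGrad (fullLoss x y) (W t)) =
      relError x y W M t * avgMiss x y (W t) := by
  rw [relError, div_mul_cancel₀ _ (avgMiss_pos hn hk _).ne']

theorem relError_nonneg (hn : 0 < n) (hk : 2 ≤ k)
    (M : ℕ → Matrix (Fin k) (Fin d) ℝ) (t : ℕ) : 0 ≤ relError x y W M t :=
  div_nonneg (entrySum_nonneg _) (avgMiss_pos hn hk _).le

/-- At time 0 the snapshot is the iterate itself, so V₀ is the full gradient and the error is β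
times that gradient, caused by M₋₁ = 0. -/
theorem relError_zero_le {R β : ℝ} (hn : 0 < n) (hk : 2 ≤ k)
    (hx : ∀ i, ∑ j, |x i j| ≤ R) (hβ0 : 0 ≤ β) (hβ1 : β < 1)
    (m : ℕ) (B : ℕ → Finset (Fin n)) :
    relError x y W (momentum β (vrGrad x y m B W)) 0 ≤ 2 * R := by
  rw [relError, div_le_iff₀ (avgMiss_pos hn hk _)]
  have e : momentum β (vrGrad x y m B W) 0 - matGrad (fullLoss x y) (W 0)
      = (-β) • matGrad (fullLoss x y) (W 0) := by
    simp only [momentum, vrGrad, Nat.zero_div, zero_mul, sub_self, zero_add, sub_smul, one_smul,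
      neg_smul]
    abel
  rw [e, entrySum_smul, abs_neg, abs_of_nonneg hβ0]
  have h1 := entrySum_fullGrad_le (y := y) hx (W 0)
  have h2 := entrySum_nonneg (matGrad (fullLoss x y) (W 0))
  nlinarith

/-- The error splits into the old error, the drift of the full gradient, and the error of V.
Dividing by G at time t + 1 instead of t costs the factor exp(2Rη_t). The error of V is a
batch-gradient change since the snapshot, with factor m, plus a full-gradient change, with factor 1;
hence m + 1. -/
theorem relError_succ_le {R β : ℝ} (hN : IsEntryDominatingNorm N) (hη : ∀ t, 0 ≤ η t)
    (hD : ∀ t, N (D t) ≤ 1) (hW : ∀ t, W (t + 1) = W t - η t • D t)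
    (hk : 2 ≤ k) (hR : 0 ≤ R) (hx : ∀ i, ∑ j, |x i j| ≤ R) (hβ0 : 0 ≤ β) (hβ1 : β < 1)
    {m b : ℕ} (hm : 1 ≤ m) (hb : 1 ≤ b) (hn : n = m * b) {B : ℕ → Finset (Fin n)}
    (hB : ∀ t, (B t).card = b) (t : ℕ) :
    relError x y W (momentum β (vrGrad x y m B W)) (t + 1) ≤
      β * Real.exp (2 * R * η t) * relError x y W (momentum β (vrGrad x y m B W)) t
      + β * (2 * R * (Real.exp (2 * R * η t) - 1))
      + (1 - β) * (2 * R * (m + 1) * (Real.exp (2 * R *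
          (totalStep η (t + 1) - totalStep η ((t + 1) / m * m))) - 1)) := by
  have hn0 : 0 < n := hn ▸ Nat.mul_pos hm hb
  set M := momentum β (vrGrad x y m B W) with hM
  set g := fun t => matGrad (fullLoss x y) (W t) with hg
  set τ := (t + 1) / m * m with hτ
  have hτle : τ ≤ t + 1 := Nat.div_mul_le_self _ _
  set r := totalStep η (t + 1) - totalStep η τ with hr
  have hr0 : 0 ≤ r := sub_nonneg.2 (totalStep_mono hη hτle)
  have hG := avgMiss_pos (x := x) (y := y) hn0 hk (W (t + 1))
  set G := avgMiss x y (W (t + 1)) with hGdef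
  have hstep : totalStep η (t + 1) - totalStep η t = η t := by
    rw [totalStep_succ]
    ring
  rw [relError, div_le_iff₀ hG]
  have e : M (t + 1) - g (t + 1) = β • (M t - g t) + β • (g t - g (t + 1))
      + (1 - β) • (-(matGrad (batchLoss x y (B (t + 1))) (W τ)
          - matGrad (batchLoss x y (B (t + 1))) (W (t + 1))) + (g τ - g (t + 1))) := by
    have : M (t + 1) = β • M t + (1 - β) • vrGrad x y m B W (t + 1) := rfl
    rw [this, vrGrad]
    simp only [hg, ← hτ]
    module
  have h1 : entrySum (M t - g t) ≤ relError x y W M t * (Real.exp (2 * R * η t) * G) := by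
    rw [hg, entrySum_eq_relError_mul hn0 hk]
    refine mul_le_mul_of_nonneg_left ?_ (relError_nonneg hn0 hk _ _)
    have := avgMiss_le (y := y) hx (hη t) (W' := W t) (W := W (t + 1)) fun c j => by
      rw [← hstep]
      exact abs_sub_iterate_le hN hη hD hW (Nat.le_succ t) c j
    rwa [show 2 * (η t * R) = 2 * R * η t by ring] at this
  have hfull : ∀ s, s ≤ t + 1 → entrySum (g s - g (t + 1)) ≤
      2 * R * (Real.exp (2 * R * (totalStep η (t + 1) - totalStep η s)) - 1) * G := by
    intro s hs
    have := entrySum_batchGrad_sub_le (y := y) hR hx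
      (sub_nonneg.2 (totalStep_mono hη hs)) (abs_sub_iterate_le hN hη hD hW hs) Finset.univ
    rw [Finset.card_univ, Fintype.card_fin, div_self (by positivity), one_mul] at this
    rw [show 2 * R * (totalStep η (t + 1) - totalStep η s)
      = 2 * ((totalStep η (t + 1) - totalStep η s) * R) by ring]
    exact this
  have h2 := hfull t (Nat.le_succ t)
  rw [hstep] at h2
  have h3 := hfull τ hτle
  have h4 := entrySum_batchGrad_sub_le (y := y) hR hx
      (sub_nonneg.2 (totalStep_mono hη hτle)) (abs_sub_iterate_le hN hη hD hW hτle) (B (t + 1))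
  have hnm : (n : ℝ) / (B (t + 1)).card = m := by
    rw [hB, hn]
    push_cast
    field_simp
  rw [hnm, ← hr, show 2 * (r * R) = 2 * R * r by ring] at h4
  rw [← hr] at h3
  change entrySum (M (t + 1) - g (t + 1)) ≤ _
  rw [e]
  have h1β : 0 ≤ 1 - β := by linarith
  have a1 := entrySum_add_le (β • (M t - g t) + β • (g t - g (t + 1)))
    ((1 - β) • (-(matGrad (batchLoss x y (B (t + 1))) (W τ)
          - matGrad (batchLoss x y (B (t + 1))) (W (t + 1))) + (g τ - g (t + 1))))
  have a2 := entrySum_add_le (β • (M t - g t)) (β • (g t - g (t + 1)))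
  have a3 := entrySum_add_le (-(matGrad (batchLoss x y (B (t + 1))) (W τ)
          - matGrad (batchLoss x y (B (t + 1))) (W (t + 1)))) (g τ - g (t + 1))
  rw [entrySum_smul, abs_of_nonneg h1β] at a1
  rw [entrySum_smul, entrySum_smul, abs_of_nonneg hβ0] at a2
  rw [entrySum_neg] at a3
  have c1 := mul_le_mul_of_nonneg_left h1 hβ0
  have c2 := mul_le_mul_of_nonneg_left h2 hβ0
  have c3 := mul_le_mul_of_nonneg_left (a3.trans (add_le_add h4 h3)) h1β
  calc _ ≤ β * (relError x y W M t * (Real.exp (2 * R * η t) * G))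
        + β * (2 * R * (Real.exp (2 * R * η t) - 1) * G)
        + (1 - β) * (m * (2 * R * (Real.exp (2 * R * r) - 1) * G)
          + 2 * R * (Real.exp (2 * R * r) - 1) * G) := by linarith
    _ = _ := by ring

/-- One step of steepest descent decreases the loss. -/
theorem fullLoss_succ_le {R γ : ℝ} (hN : IsEntryDominatingNorm N) {M : ℕ → Matrix (Fin k) (Fin d) ℝ}
    (hD : ∀ t, IsSteepest N (M t) (D t)) (hW : ∀ t, W (t + 1) = W t - η t • D t)
    (hn : 0 < n) (hk : 2 ≤ k) (hx : ∀ i, ∑ j, |x i j| ≤ R) (hγ : 0 < γ)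
    (hmax : maxMargin N x y = γ) {t : ℕ} (hη : 0 ≤ η t) (hηR : 2 * R * η t ≤ 1) :
    fullLoss x y (W (t + 1)) ≤ fullLoss x y (W t)
      - η t * (γ - 2 * relError x y W M t - 4 * R ^ 2 * η t) * avgMiss x y (W t) := by
  have hG := avgMiss_pos (x := x) (y := y) hn hk (W t)
  have hDe : ∀ c j, |D t c j| ≤ 1 := fun c j => (hN.entry_le _ _ _).trans (hD t).1
  have herr := entrySum_eq_relError_mul (x := x) (y := y) (W := W) hn hk M t
  set g := matGrad (fullLoss x y) (W t) with hg
  set e := relError x y W M t with he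
  set G := avgMiss x y (W t) with hGdef
  -- The competitor in the steepest-descent problem is −E for E of margin above γ'. The momentum
  -- error enters twice, once paired with D and once with −E.
  have key : ∀ γ', γ' < γ → (γ' - 2 * e) * G ≤ (gᵀ * D t).trace := by
    intro γ' hγ'
    obtain ⟨E, hE, hmE⟩ := exists_lt_minMargin hmax hγ hγ'
    have hnegE : N (-E) ≤ 1 := by
      have := hN.smul_le (-1) E
      rw [neg_one_smul, abs_neg, abs_one, one_mul] at this
      exact this.trans hE
    have h1 := (hD t).2 (-E) hnegE
    have h2 := trace_fullGrad_le_neg_margin (x := x) (y := y) (W t) E (g := γ')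
      fun i c hc => hmE.le.trans (minMargin_le E i c hc)
    have h3 := abs_trace_le_entrySum (M t - g) (D t) hDe
    have h4 := abs_trace_le_entrySum (M t - g) (-E) fun c j => (hN.entry_le _ _ _).trans hnegE
    rw [herr, Matrix.transpose_sub, Matrix.sub_mul, Matrix.trace_sub] at h3 h4
    have h3' := (abs_le.1 h3).2
    have h4' := (abs_le.1 h4).1
    have h5 : (gᵀ * -E).trace = -(gᵀ * E).trace := by rw [Matrix.mul_neg, Matrix.trace_neg]
    linarith
  have key' : (γ - 2 * e) * G ≤ (gᵀ * D t).trace := by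
    refine le_of_forall_pos_sub_le fun ε hε => ?_
    have := key (γ - ε / G) (by linarith [div_pos hε hG])
    have h : ε / G * G = ε := div_mul_cancel₀ _ hG.ne'
    linarith
  have hEn : ∀ c j, |(-(η t • D t)) c j| ≤ η t := by
    intro c j
    rw [Matrix.neg_apply, abs_neg, Matrix.smul_apply, smul_eq_mul, abs_mul, abs_of_nonneg hη]
    exact mul_le_of_le_one_right hη (hDe c j)
  have hmain := fullLoss_add_le (y := y) hx hη (by linarith) (W t) hEn
  rw [← sub_eq_add_neg, ← hW, Matrix.mul_neg, Matrix.trace_neg, Matrix.mul_smul,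
    Matrix.trace_smul, smul_eq_mul, ← hg] at hmain
  have := mul_le_mul_of_nonneg_left key' hη
  linarith

end Trajectory

end VRSteepest

namespace VRSteepest

/-! ### The potential exp(nL) − 1 -/

section Potential

/-- Convexity of exp between −h and 0 with weight 1 − e^{-z} gives exp(−h(1 − e^{-z})) ≤ e^{-z} + (1
− e^{-z})e^{-h}; multiply by e^z. The full factor e^{-h} is gained for small and large z alike, so
no separate phase is needed in which the loss becomes small. -/
theorem exp_sub_one_le_of_decrease {z z' h : ℝ} (hz : 0 ≤ z)
    (hz' : z' ≤ z - h * (1 - Real.exp (-z))) :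
    Real.exp z' - 1 ≤ Real.exp (-h) * (Real.exp z - 1) := by
  have he1 : Real.exp (-z) ≤ 1 := Real.exp_le_one_iff.2 (by linarith)
  have hconv := convexOn_exp.2 (Set.mem_univ (0 : ℝ)) (Set.mem_univ (-h))
    (Real.exp_pos (-z)).le (sub_nonneg.2 he1) (by ring)
  simp only [smul_eq_mul, mul_zero, zero_add, Real.exp_zero, mul_one] at hconv
  have h1 : Real.exp z' ≤ Real.exp z * Real.exp ((1 - Real.exp (-z)) * -h) := by
    rw [← Real.exp_add]
    exact Real.exp_le_exp.2 (by linarith)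
  have h2 : Real.exp z * Real.exp (-z) = 1 := by rw [← Real.exp_add]; simp
  have h3 := mul_le_mul_of_nonneg_left hconv (Real.exp_pos z).le
  have h4 : Real.exp z * (Real.exp (-z) + (1 - Real.exp (-z)) * Real.exp (-h))
      = 1 + Real.exp (-h) * (Real.exp z - 1) := by
    linear_combination (1 - Real.exp (-h)) * h2
  linarith

theorem exp_loss_sub_one_le {L G h : ℕ → ℝ} {n : ℝ} (hn : 0 ≤ n) {T : ℕ} (hL : ∀ t, 0 ≤ L t)
    (hh : ∀ t, T ≤ t → 0 ≤ h t) (hG : ∀ t, 1 - Real.exp (-(n * L t)) ≤ n * G t)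
    (hstep : ∀ t, T ≤ t → L (t + 1) ≤ L t - h t * G t) {t : ℕ} (ht : T ≤ t) :
    Real.exp (n * L t) - 1 ≤ Real.exp (n * L T - ∑ s ∈ Finset.Ico T t, h s) := by
  induction t, ht using Nat.le_induction with
  | base => simp
  | succ t ht ih =>
    have h1 : n * L (t + 1) ≤ n * L t - h t * (1 - Real.exp (-(n * L t))) := by
      have := mul_le_mul_of_nonneg_left (hstep t ht) hn
      have := mul_le_mul_of_nonneg_left (hG t) (hh t ht)
      linarith
    have h2 := exp_sub_one_le_of_decrease (mul_nonneg hn (hL t)) h1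
    rw [Finset.sum_Ico_succ_top ht]
    refine h2.trans ((mul_le_mul_of_nonneg_left ih (Real.exp_pos _).le).trans (le_of_eq ?_))
    rw [← Real.exp_add]
    congr 1
    ring

end Potential

theorem exp_sub_one_le_two_mul {z : ℝ} (h0 : 0 ≤ z) (h1 : z ≤ 1) : Real.exp z - 1 ≤ 2 * z := by
  have := (abs_le.1 (Real.abs_exp_sub_one_le (x := z) (by rwa [abs_of_nonneg h0]))).2
  rwa [abs_of_nonneg h0] at this

/-! ### Regularity of the step sizes -/

section StepSize

variable {a c η₀ : ℝ}

theorem stepSize_of_pos {t : ℕ} (ht : 1 ≤ t) :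
    stepSize a c η₀ t = c * (t : ℝ) ^ (-a) := by
  rw [stepSize, if_neg (by omega)]

theorem stepSize_nonneg (hc : 0 < c) (h0 : 0 ≤ η₀) (t : ℕ) : 0 ≤ stepSize a c η₀ t := by
  rw [stepSize]
  split_ifs <;> positivity

theorem stepSize_le_two_mul (ha₀ : 0 < a) (ha₁ : a ≤ 1) (hc : 0 < c) {s t : ℕ} (hs : 1 ≤ s)
    (ht : 1 ≤ t) (hst : t ≤ 2 * s) : stepSize a c η₀ s ≤ 2 * stepSize a c η₀ t := by
  rw [stepSize_of_pos hs, stepSize_of_pos ht]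
  have hs' : (0 : ℝ) < s := by exact_mod_cast hs
  have ht' : (0 : ℝ) < t := by exact_mod_cast ht
  have hst' : (t : ℝ) ≤ 2 * s := by exact_mod_cast hst
  have h1 : (2 * s : ℝ) ^ (-a) ≤ (t : ℝ) ^ (-a) :=
    Real.rpow_le_rpow_of_nonpos ht' hst' (by linarith)
  rw [Real.mul_rpow (by norm_num) hs'.le] at h1
  have h2 : (2 : ℝ)⁻¹ ≤ (2 : ℝ) ^ (-a) := by
    rw [← Real.rpow_neg_one]
    exact Real.rpow_le_rpow_of_exponent_le (by norm_num) (by linarith)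
  have h3 : 0 < (s : ℝ) ^ (-a) := Real.rpow_pos_of_pos hs' _
  have h4 : (s : ℝ) ^ (-a) ≤ 2 * (t : ℝ) ^ (-a) := by nlinarith
  nlinarith

theorem stepSize_le_succ (ha₁ : a ≤ 1) (hc : 0 < c) {t : ℕ} (ht : 1 ≤ t) :
    stepSize a c η₀ t ≤ (1 + 1 / t) * stepSize a c η₀ (t + 1) := by
  rw [stepSize_of_pos ht, stepSize_of_pos (by omega)]
  have ht' : (0 : ℝ) < t := by exact_mod_cast ht
  have e : ((t + 1 : ℕ) : ℝ) = t * (1 + 1 / t) := by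
    push_cast
    field_simp
  have h0 : (0 : ℝ) < 1 + 1 / t := by positivity
  have h1 : (1 + 1 / t : ℝ)⁻¹ ≤ (1 + 1 / t : ℝ) ^ (-a) := by
    rw [← Real.rpow_neg_one]
    refine Real.rpow_le_rpow_of_exponent_le ?_ (by linarith)
    have : (0 : ℝ) < 1 / t := by positivity
    linarith
  have h3 : 0 < (t : ℝ) ^ (-a) := Real.rpow_pos_of_pos ht' _
  rw [e, Real.mul_rpow ht'.le h0.le]
  have h4 : 1 ≤ (1 + 1 / t : ℝ) * (1 + 1 / t : ℝ) ^ (-a) := by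
    have := mul_le_mul_of_nonneg_left h1 h0.le
    rwa [mul_inv_cancel₀ h0.ne'] at this
  have h5 : 0 < c * (t : ℝ) ^ (-a) := by positivity
  nlinarith

theorem div_le_stepSize (ha₁ : a ≤ 1) (hc : 0 < c) {t : ℕ} (ht : 1 ≤ t) :
    c / t ≤ stepSize a c η₀ t := by
  rw [stepSize_of_pos ht, div_eq_mul_inv, ← Real.rpow_neg_one]
  have ht' : (1 : ℝ) ≤ t := by exact_mod_cast ht
  gcongr

end StepSize

/-! ### Solving the error recursion -/

section RelError

variable {R β : ℝ} {m : ℕ} {e : ℕ → ℝ}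

/-- The recursive inequality satisfied by the relative error of the momentum. -/
def ErrorRecursion (R β : ℝ) (m : ℕ) (η e : ℕ → ℝ) : Prop :=
  e 0 ≤ 2 * R ∧ ∀ t, e (t + 1) ≤ β * Real.exp (2 * R * η t) * e t
      + β * (2 * R * (Real.exp (2 * R * η t) - 1))
      + (1 - β) * (2 * R * (m + 1) * (Real.exp (2 * R *
          (totalStep η (t + 1) - totalStep η ((t + 1) / m * m))) - 1))

/-- A crude bound for the burn-in, where steps need not be small. Adding 2R merges the two β-terms
into β exp(2Rη)(e + 2R), which makes the induction close. -/
theorem ErrorRecursion.le_exp {η : ℕ → ℝ} (he : ErrorRecursion R β m η e) (hR : 0 < R)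
    (hβ0 : 0 ≤ β) (hβ1 : β < 1) (hm : 1 ≤ m) (hη : ∀ t, 0 ≤ η t) (t : ℕ) :
    e t + 2 * R ≤ 2 * R * (m + 1) * Real.exp (2 * R * totalStep η t) := by
  have hm' : (1 : ℝ) ≤ m := by exact_mod_cast hm
  induction t with
  | zero =>
    simp only [totalStep, Finset.range_zero, Finset.sum_empty, mul_zero, Real.exp_zero, mul_one]
    nlinarith [he.1]
  | succ t ih =>
    have h0 := he.2 t
    have hS : 0 ≤ totalStep η ((t + 1) / m * m) := Finset.sum_nonneg fun s _ => hη s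
    set E := Real.exp (2 * R * (totalStep η (t + 1) - totalStep η ((t + 1) / m * m)))
    have hE : E ≤ Real.exp (2 * R * totalStep η (t + 1)) :=
      Real.exp_le_exp.2 (by nlinarith)
    have hQ : Real.exp (2 * R * totalStep η (t + 1))
        = Real.exp (2 * R * η t) * Real.exp (2 * R * totalStep η t) := by
      rw [totalStep_succ, ← Real.exp_add]
      congr 1
      ring
    have h1 : β * Real.exp (2 * R * η t) * (e t + 2 * R) ≤
        β * (2 * R * (m + 1) * Real.exp (2 * R * totalStep η (t + 1))) := by
      rw [hQ]
      have := mul_le_mul_of_nonneg_left ih (mul_nonneg hβ0 (Real.exp_pos (2 * R * η t)).le)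
      linarith
    have h2 : (1 - β) * (2 * R * (m + 1) * E) ≤
        (1 - β) * (2 * R * (m + 1) * Real.exp (2 * R * totalStep η (t + 1))) := by
      have : 0 ≤ 1 - β := by linarith
      gcongr
    have h3 : 0 ≤ (1 - β) * (2 * R * m) := by
      have : 0 ≤ 1 - β := by linarith
      positivity
    linarith

variable {a c η₀ : ℝ}

/-- Fewer than m steps have been made since the snapshot. All lie after t/2 because t ≥ 2m, so each
is at most twice the current step. -/
theorem totalStep_sub_epoch_le (ha₀ : 0 < a) (ha₁ : a ≤ 1) (hc : 0 < c)
    (hm : 1 ≤ m) {t : ℕ} (ht : 2 * m ≤ t) :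
    totalStep (stepSize a c η₀) t - totalStep (stepSize a c η₀) (t / m * m)
      ≤ 2 * m * stepSize a c η₀ t := by
  have h1 : t / m * m ≤ t := Nat.div_mul_le_self _ _
  have h2 : t < t / m * m + m := by
    have := Nat.lt_div_mul_add (a := t) (b := m) (by omega)
    omega
  rw [totalStep, totalStep, ← Finset.sum_Ico_eq_sub _ h1]
  have hpos : 0 ≤ stepSize a c η₀ t := by
    rw [stepSize_of_pos (by omega)]
    positivity
  calc _ ≤ ∑ _s ∈ Finset.Ico (t / m * m) t, 2 * stepSize a c η₀ t := by
        refine Finset.sum_le_sum fun s hs => ?_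
        rw [Finset.mem_Ico] at hs
        exact stepSize_le_two_mul ha₀ ha₁ hc (by omega) (by omega) (by omega)
    _ = ((t - t / m * m : ℕ) : ℝ) * (2 * stepSize a c η₀ t) := by simp
    _ ≤ m * (2 * stepSize a c η₀ t) := by
        gcongr
        omega
    _ = _ := by ring

/-- Half of the gap 1 − β absorbs exp(2Rη), since smallness of Xη and X(1 − β) ≥ 1 force Rη ≤ (1 −
β)/16. The gradient drift contributes 16 and the snapshot error 32 to the constant 48. -/
theorem ErrorRecursion.step_le (he : ErrorRecursion R β m (stepSize a c η₀) e)
    (hpos : ∀ t, 0 ≤ e t) (ha₀ : 0 < a) (ha₁ : a ≤ 1) (hc : 0 < c) (h0 : 0 ≤ η₀) (hR : 0 < R)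
    (hβ0 : 0 ≤ β) (hβ1 : β < 1) (hm : 1 ≤ m) {X : ℝ} (hX : X * (1 - β) = m ^ 2) {t : ℕ}
    (htX : 4 * X ≤ t) (hXη : X * stepSize a c η₀ t ≤ 1 / (16 * R))
    (hXη' : X * stepSize a c η₀ (t + 1) ≤ 1 / (16 * R)) :
    e (t + 1) ≤ (1 + β) / 2 * e t + 48 * R ^ 2 * (1 - β) * (X * stepSize a c η₀ (t + 1)) := by
  have hm' : (1 : ℝ) ≤ m := by exact_mod_cast hm
  have hXm : (m : ℝ) ≤ X := by nlinarith
  have hX1 : 1 ≤ X := hm'.trans hXm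
  have ht4 : 4 * m ≤ t := by
    have : (4 * m : ℝ) ≤ t := by linarith
    exact_mod_cast this
  have hη := stepSize_nonneg (a := a) hc h0 t
  have hη' := stepSize_nonneg (a := a) hc h0 (t + 1)
  have htwo : stepSize a c η₀ t ≤ 2 * stepSize a c η₀ (t + 1) :=
    stepSize_le_two_mul ha₀ ha₁ hc (by omega) (by omega) (by omega)
  have hδ := totalStep_sub_epoch_le (η₀ := η₀) ha₀ ha₁ hc hm (t := t + 1) (by omega)
  have hδ0 : 0 ≤ totalStep (stepSize a c η₀) (t + 1)
      - totalStep (stepSize a c η₀) ((t + 1) / m * m) :=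
    sub_nonneg.2 (totalStep_mono (stepSize_nonneg hc h0) (Nat.div_mul_le_self _ _))
  have hrec := he.2 t
  set η := stepSize a c η₀ t
  set η' := stepSize a c η₀ (t + 1)
  set δ := totalStep (stepSize a c η₀) (t + 1)
      - totalStep (stepSize a c η₀) ((t + 1) / m * m)
  have hRη : R * (X * η) ≤ 1 / 16 := by
    calc R * (X * η) ≤ R * (1 / (16 * R)) := by gcongr
      _ = 1 / 16 := by field_simp
  have hRη' : R * (X * η') ≤ 1 / 16 := by
    calc R * (X * η') ≤ R * (1 / (16 * R)) := by gcongr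
      _ = 1 / 16 := by field_simp
  have hu : 0 < 1 - β := by linarith
  have hone : 1 ≤ X * (1 - β) := by
    rw [hX]
    exact one_le_pow₀ hm'
  have hRη2 : R * η ≤ (1 - β) / 16 := by
    have h1 : R * η * 1 ≤ R * η * (X * (1 - β)) :=
      mul_le_mul_of_nonneg_left hone (by positivity)
    have h2 := mul_le_mul_of_nonneg_right hRη hu.le
    linarith
  have hexp1 : Real.exp (2 * R * η) - 1 ≤ 4 * (R * η) := by
    have := exp_sub_one_le_two_mul (z := 2 * R * η) (by positivity) (by linarith)
    linarith
  have hRmη : R * (m * η') ≤ 1 / 16 := by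
    have : R * (m * η') ≤ R * (X * η') := by gcongr
    linarith
  have hRδ : 2 * R * δ ≤ 4 * (R * (m * η')) := by
    have := mul_le_mul_of_nonneg_left hδ hR.le
    linarith
  have hexp2 : Real.exp (2 * R * δ) - 1 ≤ 8 * (R * (m * η')) := by
    have := exp_sub_one_le_two_mul (z := 2 * R * δ) (by positivity) (by linarith)
    linarith
  have hcontr : β * Real.exp (2 * R * η) ≤ (1 + β) / 2 := by
    have h1 : β * Real.exp (2 * R * η) ≤ β * (1 + (1 - β) / 4) := by
      gcongr
      linarith
    nlinarith
  have t1 : β * Real.exp (2 * R * η) * e t ≤ (1 + β) / 2 * e t :=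
    mul_le_mul_of_nonneg_right hcontr (hpos t)
  have hb : 0 ≤ R ^ 2 * η' := by positivity
  have t2 : β * (2 * R * (Real.exp (2 * R * η) - 1)) ≤ 16 * R ^ 2 * (1 - β) * (X * η') := by
    calc β * (2 * R * (Real.exp (2 * R * η) - 1)) ≤ 1 * (2 * R * (4 * (R * η))) := by
          have : 0 ≤ Real.exp (2 * R * η) - 1 := sub_nonneg.2 (Real.one_le_exp (by positivity))
          gcongr
      _ ≤ 1 * (2 * R * (4 * (R * (2 * η')))) := by gcongr
      _ = 16 * (R ^ 2 * η') * 1 := by ring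
      _ ≤ 16 * (R ^ 2 * η') * (X * (1 - β)) := by gcongr
      _ = _ := by ring
  have t3 : (1 - β) * (2 * R * (m + 1) * (Real.exp (2 * R * δ) - 1))
      ≤ 32 * R ^ 2 * (1 - β) * (X * η') := by
    calc (1 - β) * (2 * R * (m + 1) * (Real.exp (2 * R * δ) - 1))
        ≤ (1 - β) * (2 * R * (m + m) * (8 * (R * (m * η')))) := by
          have : 0 ≤ Real.exp (2 * R * δ) - 1 := sub_nonneg.2 (Real.one_le_exp (by positivity))
          gcongr
      _ = 32 * (R ^ 2 * η') * (1 - β) * (m ^ 2) := by ring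
      _ = 32 * (R ^ 2 * η') * (1 - β) * (X * (1 - β)) := by rw [hX]
      _ ≤ 32 * (R ^ 2 * η') * (1 - β) * (X * 1) := by
          gcongr
          linarith
      _ = _ := by ring
  linarith

theorem ErrorRecursion.le_stepSize_add (he : ErrorRecursion R β m (stepSize a c η₀) e)
    (hpos : ∀ t, 0 ≤ e t) (ha₀ : 0 < a) (ha₁ : a ≤ 1) (hc : 0 < c) (h0 : 0 ≤ η₀) (hR : 0 < R)
    (hβ0 : 0 ≤ β) (hβ1 : β < 1) (hm : 1 ≤ m) {X : ℝ} (hX : X * (1 - β) = m ^ 2) {T : ℕ}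
    (hT : ∀ t : ℕ, T ≤ t → 4 * X ≤ t ∧ X * stepSize a c η₀ t ≤ 1 / (16 * R)) (j : ℕ) :
    e (T + j) ≤ 192 * R ^ 2 * (X * stepSize a c η₀ (T + j)) + e T * ((1 + β) / 2) ^ j := by
  have hm' : (1 : ℝ) ≤ m := by exact_mod_cast hm
  have hX1 : 1 ≤ X := by nlinarith
  induction j with
  | zero =>
    have := stepSize_nonneg (a := a) hc h0 T
    have : 0 ≤ 192 * R ^ 2 * (X * stepSize a c η₀ T) := by positivity
    simpa using this
  | succ j ih =>
    have h1 := he.step_le hpos ha₀ ha₁ hc h0 hR hβ0 hβ1 hm hX (hT _ (Nat.le_add_right T j)).1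
      (hT _ (Nat.le_add_right T j)).2 (hT (T + j + 1) (by omega)).2
    have htX := (hT _ (Nat.le_add_right T j)).1
    set t := T + j with ht
    have ht1 : 1 ≤ t := by
      have : (1 : ℝ) ≤ t := by linarith
      exact_mod_cast this
    have h2 := stepSize_le_succ (η₀ := η₀) ha₁ hc ht1
    have hη' := stepSize_nonneg (a := a) hc h0 (t + 1)
    have ht0 : (0 : ℝ) < t := by exact_mod_cast ht1
    have hinv : (1 : ℝ) / t ≤ (1 - β) / 4 := by
      rw [div_le_div_iff₀ ht0 (by norm_num)]
      have : X * (1 - β) ≥ 1 := by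
        rw [hX]
        exact one_le_pow₀ hm'
      nlinarith
    -- Because t ≥ 4X ≥ 4/(1 − β), the shrinking of the step uses up only part of the contraction
    -- and leaves 1 − (1 − β)/4. Thus 192 = 4 · 48 is reproduced by the induction.
    have h3 : (1 + β) / 2 * stepSize a c η₀ t ≤ (1 - (1 - β) / 4) * stepSize a c η₀ (t + 1) := by
      calc (1 + β) / 2 * stepSize a c η₀ t
          ≤ (1 + β) / 2 * ((1 + 1 / t) * stepSize a c η₀ (t + 1)) := by gcongr
        _ ≤ (1 + β) / 2 * ((1 + (1 - β) / 4) * stepSize a c η₀ (t + 1)) := by gcongr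
        _ ≤ _ := by
            rw [← mul_assoc]
            refine mul_le_mul_of_nonneg_right ?_ hη'
            nlinarith
    have h4 : (1 + β) / 2 * e t ≤ (1 + β) / 2 *
        (192 * R ^ 2 * (X * stepSize a c η₀ t) + e T * ((1 + β) / 2) ^ j) := by gcongr
    have h5 := mul_le_mul_of_nonneg_left h3 (by positivity : 0 ≤ 192 * R ^ 2 * X)
    rw [← add_assoc, ← ht, pow_succ ((1 + β) / 2)]
    linarith

/-- After the burn-in time the relative error is of the order of the step size. -/
theorem ErrorRecursion.le_stepSize (he : ErrorRecursion R β m (stepSize a c η₀) e)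
    (hpos : ∀ t, 0 ≤ e t) (ha₀ : 0 < a) (ha₁ : a ≤ 1) (hc : 0 < c) (h0 : 0 ≤ η₀) (hR : 0 < R)
    (hβ0 : 0 ≤ β) (hβ1 : β < 1) (hm : 1 ≤ m) {X : ℝ} (hX : X * (1 - β) = m ^ 2) {T T' : ℕ}
    (hT : ∀ t : ℕ, T ≤ t → 4 * X ≤ t ∧ X * stepSize a c η₀ t ≤ 1 / (16 * R))
    (hTT' : 2 * T ≤ T')
    (hT' : 16 * R * totalStep (stepSize a c η₀) T ≤ (1 - β) * T') {t : ℕ} (ht : T' ≤ t) :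
    e t ≤ (192 * R ^ 2 + 32 * R / c) * (X * stepSize a c η₀ t) := by
  have hm' : (1 : ℝ) ≤ m := by exact_mod_cast hm
  have hu : 0 < 1 - β := by linarith
  have hX1 : 1 ≤ X := by nlinarith
  have hTt : T ≤ t := by omega
  have ht1 : 1 ≤ t := by
    have : (1 : ℝ) ≤ t := by linarith [(hT t hTt).1]
    exact_mod_cast this
  have ht0 : (0 : ℝ) < t := by exact_mod_cast ht1
  obtain ⟨j, rfl⟩ := Nat.exists_eq_add_of_le hTt
  have h1 := he.le_stepSize_add hpos ha₀ ha₁ hc h0 hR hβ0 hβ1 hm hX hT j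
  have h2 := he.le_exp hR hβ0 hβ1 hm (stepSize_nonneg hc h0) T
  set t := T + j with htdef
  have hj : (t : ℝ) / 2 ≤ j := by
    have : (t : ℝ) ≤ 2 * j := by
      have : t ≤ 2 * j := by omega
      exact_mod_cast this
    linarith
  have hq : ((1 + β) / 2) ^ j ≤ Real.exp (-((1 - β) * t / 4)) := by
    have hq1 : (1 + β) / 2 ≤ Real.exp (-((1 - β) / 2)) := by
      linarith [Real.add_one_le_exp (-((1 - β) / 2))]
    calc ((1 + β) / 2) ^ j ≤ Real.exp (-((1 - β) / 2)) ^ j := by gcongr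
      _ = Real.exp (j * -((1 - β) / 2)) := (Real.exp_nat_mul _ _).symm
      _ ≤ _ := Real.exp_le_exp.2 (by nlinarith)
  have hS : 2 * R * totalStep (stepSize a c η₀) T ≤ (1 - β) * t / 8 := by
    have : (T' : ℝ) ≤ t := by exact_mod_cast ht
    nlinarith
  -- The choice of T' keeps the growth up to T below exp((1 − β)t/8), against a decay of exp(−(1 −
  -- β)t/4). What remains is at most 8/((1 − β)t), which is absorbed by the step size through η_t ≥
  -- c/t.
  have h3 : e T * ((1 + β) / 2) ^ j ≤ 32 * R / c * (X * stepSize a c η₀ t) := by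
    calc e T * ((1 + β) / 2) ^ j
        ≤ (2 * R * (m + 1) * Real.exp (2 * R * totalStep (stepSize a c η₀) T))
          * Real.exp (-((1 - β) * t / 4)) := by
          gcongr
          linarith
      _ ≤ (2 * R * (m + m) * Real.exp ((1 - β) * t / 8))
          * Real.exp (-((1 - β) * t / 4)) := by gcongr
      _ = 4 * R * m * Real.exp (-((1 - β) * t / 8)) := by
          rw [mul_assoc, ← Real.exp_add]
          ring_nf
      _ ≤ 4 * R * m * ((1 - β) * t / 8)⁻¹ := by
          gcongr
          rw [Real.exp_neg]
          gcongr
          linarith [Real.add_one_le_exp ((1 - β) * t / 8)]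
      _ = 32 * R * (m / (1 - β)) * (1 / t) := by
          field_simp
          ring
      _ ≤ 32 * R * X * (1 / t) := by
          gcongr
          rw [div_le_iff₀ hu, hX]
          nlinarith
      _ = 32 * R / c * (X * (c / t)) := by field_simp
      _ ≤ _ := by
          gcongr
          exact div_le_stepSize ha₁ hc ht1
  linarith

end RelError

end VRSteepest

namespace VRSteepest

/-! ### Sums of powers -/

/-- The partial sums `∑ j ^ (-s)` over `1 ≤ j < t`. -/
noncomputable def powSum (s : ℝ) (t : ℕ) : ℝ := ∑ j ∈ Finset.Ico 1 t, (j : ℝ) ^ (-s)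

theorem powSum_nonneg (s : ℝ) (t : ℕ) : 0 ≤ powSum s t :=
  Finset.sum_nonneg fun _ _ => by positivity

theorem powSum_succ (s : ℝ) {t : ℕ} (ht : 1 ≤ t) :
    powSum s (t + 1) = powSum s t + (t : ℝ) ^ (-s) :=
  Finset.sum_Ico_succ_top ht _

theorem powSum_mono (s : ℝ) : Monotone (powSum s) := fun _ _ h =>
  Finset.sum_le_sum_of_subset_of_nonneg (Finset.Ico_subset_Ico_right h) fun _ _ _ => by positivity

/-- A discrete integral comparison: Bernoulli's inequality shows that one increment of t^{1-s}/(1 −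
s) is at least the next summand. -/
theorem powSum_le_of_lt_one {s : ℝ} (hs0 : 0 ≤ s) (hs1 : s < 1) (t : ℕ) :
    powSum s t ≤ (t : ℝ) ^ (1 - s) / (1 - s) := by
  have h1s : 0 < 1 - s := by linarith
  have key : ∀ t : ℕ, powSum s (t + 1) ≤ (t : ℝ) ^ (1 - s) / (1 - s) := by
    intro t
    induction t with
    | zero =>
      simp only [powSum, zero_add, Finset.Ico_self, Finset.sum_empty]
      positivity
    | succ t ih =>
      rw [powSum_succ s (by omega)]
      have ht : (0 : ℝ) < ((t + 1 : ℕ) : ℝ) := by positivity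
      have ht1 : (1 : ℝ) ≤ ((t + 1 : ℕ) : ℝ) := by
        push_cast
        linarith [(Nat.cast_nonneg t : (0 : ℝ) ≤ t)]
      have e : (t : ℝ) = ((t + 1 : ℕ) : ℝ) * (1 + -((t + 1 : ℕ) : ℝ)⁻¹) := by
        rw [mul_add, mul_neg, mul_inv_cancel₀ ht.ne']
        push_cast
        ring
      have hinv : ((t + 1 : ℕ) : ℝ)⁻¹ ≤ 1 := inv_le_one_of_one_le₀ ht1
      have hb := rpow_one_add_le_one_add_mul_self (s := -((t + 1 : ℕ) : ℝ)⁻¹) (by linarith)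
        h1s.le (by linarith : 1 - s ≤ 1)
      have h2 : (t : ℝ) ^ (1 - s) ≤ ((t + 1 : ℕ) : ℝ) ^ (1 - s)
          - (1 - s) * ((t + 1 : ℕ) : ℝ) ^ (-s) := by
        calc (t : ℝ) ^ (1 - s)
            = ((t + 1 : ℕ) : ℝ) ^ (1 - s) * (1 + -((t + 1 : ℕ) : ℝ)⁻¹) ^ (1 - s) := by
              rw [← Real.mul_rpow ht.le (by linarith), ← e]
          _ ≤ ((t + 1 : ℕ) : ℝ) ^ (1 - s) * (1 + (1 - s) * -((t + 1 : ℕ) : ℝ)⁻¹) := by gcongr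
          _ = _ := by
              rw [sub_eq_add_neg 1 s, Real.rpow_add ht, Real.rpow_one]
              field_simp
              ring
      have h3 : (t : ℝ) ^ (1 - s) / (1 - s) ≤ ((t + 1 : ℕ) : ℝ) ^ (1 - s) / (1 - s)
          - ((t + 1 : ℕ) : ℝ) ^ (-s) := by
        rw [div_sub' h1s.ne']
        gcongr
      linarith
  exact (powSum_mono s (Nat.le_succ t)).trans (key t)

theorem powSum_one_succ (t : ℕ) : powSum 1 (t + 1) = harmonic t := by
  rw [harmonic_eq_sum_Icc, powSum]
  push_cast
  refine Finset.sum_congr rfl fun j _ => ?_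
  rw [Real.rpow_neg_one]

theorem powSum_one_le (t : ℕ) : powSum 1 t ≤ 1 + Real.log t := by
  refine (powSum_mono 1 (Nat.le_succ t)).trans ?_
  rw [Nat.succ_eq_add_one, powSum_one_succ]
  exact harmonic_le_one_add_log t

theorem powSum_le_tsum {s : ℝ} (hs : 1 < s) (t : ℕ) :
    powSum s t ≤ ∑' j : ℕ, (j : ℝ) ^ (-s) :=
  (Real.summable_nat_rpow.2 (by linarith)).sum_le_tsum _ fun _ _ => by positivity

theorem log_le_powSum {s : ℝ} (hs : s ≤ 1) {t : ℕ} (ht : 1 ≤ t) : Real.log t ≤ powSum s t := by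
  obtain ⟨t, rfl⟩ := Nat.exists_eq_add_of_le' ht
  refine (log_add_one_le_harmonic t).trans ?_
  rw [← powSum_one_succ]
  refine Finset.sum_le_sum fun j hj => ?_
  rw [Finset.mem_Ico] at hj
  exact Real.rpow_le_rpow_of_exponent_le (by exact_mod_cast hj.1) (by linarith)

theorem rpow_div_two_le_powSum {s : ℝ} (hs : 0 ≤ s) {t : ℕ} (ht : 2 ≤ t) :
    (t : ℝ) ^ (1 - s) / 2 ≤ powSum s t := by
  have ht' : (2 : ℝ) ≤ t := by exact_mod_cast ht
  have ht0 : (0 : ℝ) < t := by linarith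
  calc (t : ℝ) ^ (1 - s) / 2 = t / 2 * (t : ℝ) ^ (-s) := by
        rw [sub_eq_add_neg, Real.rpow_add ht0, Real.rpow_one]
        ring
    _ ≤ ((t - 1 : ℕ) : ℝ) * (t : ℝ) ^ (-s) := by
        rw [Nat.cast_sub (by omega)]
        push_cast
        gcongr
        linarith
    _ = ∑ _j ∈ Finset.Ico 1 t, (t : ℝ) ^ (-s) := by simp
    _ ≤ powSum s t := by
        refine Finset.sum_le_sum fun j hj => ?_
        rw [Finset.mem_Ico] at hj
        refine Real.rpow_le_rpow_of_nonpos ?_ ?_ (by linarith)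
        · exact_mod_cast hj.1
        · exact_mod_cast hj.2.le

/-! ### Length of the burn-in -/

section BurnIn

variable {a c : ℝ}

theorem exists_burnIn (ha₀ : 0 < a) (ha₁ : a ≤ 1) (hc : 0 < c) {ε : ℝ} (hε : 0 < ε) :
    ∃ κ : ℝ, 4 ≤ κ ∧ ∀ X : ℝ, 1 ≤ X → ∀ t : ℝ, κ * X ^ (1 / a) ≤ t →
      4 * X ≤ t ∧ X * (c * t ^ (-a)) ≤ ε := by
  refine ⟨max 4 ((c / ε) ^ (1 / a)), le_max_left _ _, fun X hX t ht => ?_⟩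
  have hX0 : 0 < X := by linarith
  have hXa : 0 < X ^ (1 / a) := by positivity
  have h1a : 1 ≤ 1 / a := by rw [le_div_iff₀ ha₀]; linarith
  have hXX : X ≤ X ^ (1 / a) := by
    simpa using Real.rpow_le_rpow_of_exponent_le hX h1a
  have h1 : 4 * X ^ (1 / a) ≤ t :=
    (mul_le_mul_of_nonneg_right (le_max_left _ _) hXa.le).trans ht
  have h2 : (c / ε) ^ (1 / a) * X ^ (1 / a) ≤ t :=
    (mul_le_mul_of_nonneg_right (le_max_right _ _) hXa.le).trans ht
  have ht0 : 0 < t := by linarith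
  refine ⟨by linarith, ?_⟩
  rw [← Real.mul_rpow (by positivity) hX0.le] at h2
  have h3 := Real.rpow_le_rpow (by positivity) h2 ha₀.le
  rw [← Real.rpow_mul (by positivity), one_div_mul_cancel ha₀.ne', Real.rpow_one] at h3
  have hta : 0 < t ^ a := by positivity
  rw [Real.rpow_neg ht0.le]
  have e : X * (c * (t ^ a)⁻¹) = (c / ε * X) / t ^ a * ε := by
    field_simp
  rw [e]
  exact mul_le_of_le_one_left hε.le (div_le_one_of_le₀ h3 hta.le)

/-- The source of the exponent 1/a − 1 in the result: a time of order X^{1/a} raised to the power 1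
− a. -/
theorem powSum_le_of_le_mul_rpow (ha₀ : 0 < a) (ha₁ : a < 1) {κ X : ℝ} (hκ : 1 ≤ κ) (hX : 1 ≤ X)
    {T : ℕ} (hT : T ≤ κ * X ^ (1 / a)) : powSum a T ≤ κ / (1 - a) * X ^ (1 / a - 1) := by
  have h1a : 0 < 1 - a := by linarith
  have hX0 : 0 ≤ X := by linarith
  refine (powSum_le_of_lt_one ha₀.le ha₁ T).trans ?_
  rw [div_mul_eq_mul_div]
  gcongr
  calc (T : ℝ) ^ (1 - a) ≤ (κ * X ^ (1 / a)) ^ (1 - a) := by gcongr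
    _ = κ ^ (1 - a) * X ^ (1 / a - 1) := by
        rw [Real.mul_rpow (by positivity) (by positivity), ← Real.rpow_mul hX0]
        congr 2
        field_simp
    _ ≤ κ ^ (1 : ℝ) * X ^ (1 / a - 1) := by
        gcongr
        linarith
    _ = _ := by rw [Real.rpow_one]

/-- T makes the steps small; T' also leaves time for the error accumulated up to T to decay
geometrically. The lemma is applied with u = 1/(1 − β). The constant K is fixed before X and u,
hence independent of n, m, b and β. -/
theorem exists_times (ha₀ : 0 < a) (ha₁ : a ≤ 1) (hc : 0 < c) {R ε : ℝ} (hR : 0 < R)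
    (hε : 0 < ε) :
    ∃ K : ℝ, 0 < K ∧ ∀ X u : ℝ, 1 ≤ X → 0 < u → u ≤ X → ∃ T T' : ℕ,
      (∀ t : ℕ, T ≤ t → 4 * X ≤ t ∧ X * (c * (t : ℝ) ^ (-a)) ≤ ε) ∧ 2 * T ≤ T' ∧
      16 * R * (c + c * powSum a T) * u ≤ T' ∧
      (a < 1 → 1 + powSum a T' ≤ K * X ^ (1 / a - 1)) ∧
      (a = 1 → 1 + powSum a T' ≤ K * (1 + Real.log X)) := by
  obtain ⟨κ, hκ, hburn⟩ := exists_burnIn ha₀ ha₁ hc hε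
  suffices h : ∃ K : ℝ, 0 < K ∧ ∀ X u : ℝ, 1 ≤ X → 0 < u → u ≤ X → ∀ T T' : ℕ,
      T = ⌈κ * X ^ (1 / a)⌉₊ → T' = ⌈2 * T + 16 * R * (c + c * powSum a T) * u⌉₊ →
      (a < 1 → 1 + powSum a T' ≤ K * X ^ (1 / a - 1)) ∧
      (a = 1 → 1 + powSum a T' ≤ K * (1 + Real.log X)) by
    obtain ⟨K, hK, h⟩ := h
    refine ⟨K, hK, fun X u hX hu huX => ⟨⌈κ * X ^ (1 / a)⌉₊,
      ⌈2 * (⌈κ * X ^ (1 / a)⌉₊ : ℝ) + 16 * R * (c + c * powSum a ⌈κ * X ^ (1 / a)⌉₊) * u⌉₊,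
      fun t ht => ?_, ?_, ?_, h X u hX hu huX _ _ rfl rfl⟩⟩
    · exact hburn X hX t ((Nat.le_ceil _).trans (by exact_mod_cast ht))
    · have h1 := Nat.le_ceil (2 * (⌈κ * X ^ (1 / a)⌉₊ : ℝ)
        + 16 * R * (c + c * powSum a ⌈κ * X ^ (1 / a)⌉₊) * u)
      have h2 : 0 ≤ 16 * R * (c + c * powSum a ⌈κ * X ^ (1 / a)⌉₊) * u := by
        have := powSum_nonneg a ⌈κ * X ^ (1 / a)⌉₊
        positivity
      have h3 : (2 * (⌈κ * X ^ (1 / a)⌉₊ : ℝ)) ≤ _ := (le_add_of_nonneg_right h2).trans h1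
      exact_mod_cast h3
    · refine le_trans ?_ (Nat.le_ceil _)
      exact le_add_of_nonneg_left (by positivity)
  have hceil : ∀ X u : ℝ, 1 ≤ X → 0 < u → u ≤ X → ∀ T T' : ℕ, T = ⌈κ * X ^ (1 / a)⌉₊ →
      T' = ⌈2 * T + 16 * R * (c + c * powSum a T) * u⌉₊ →
      (T : ℝ) ≤ (κ + 1) * X ^ (1 / a) ∧
        (T' : ℝ) ≤ 2 * T + 16 * R * (c + c * powSum a T) * u + 1 ∧ 1 ≤ T ∧ 1 ≤ T' := by
    intro X u hX hu huX T T' hT hT'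
    have hXa : 1 ≤ X ^ (1 / a) := Real.one_le_rpow hX (by positivity)
    have hT1 : 1 ≤ T := by
      rw [hT, Nat.one_le_ceil_iff]
      positivity
    have hT1' : (1 : ℝ) ≤ T := by exact_mod_cast hT1
    have hP := powSum_nonneg a T
    refine ⟨?_, ?_, hT1, ?_⟩
    · have := (Nat.ceil_lt_add_one (by positivity : 0 ≤ κ * X ^ (1 / a))).le
      rw [← hT] at this
      linarith
    · rw [hT']
      exact (Nat.ceil_lt_add_one (by positivity)).le
    · rw [hT', Nat.one_le_ceil_iff]
      positivity
  rcases ha₁.lt_or_eq with ha | rfl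
  · have h1a : 0 < 1 - a := by linarith
    set k₁ := 1 + (κ + 1) / (1 - a) with hk₁
    have hk₁0 : 0 < k₁ := by positivity
    set k₂ := 2 * (κ + 1) + 16 * R * c * k₁ + 1 with hk₂
    have hk₂1 : 1 ≤ k₂ := by
      have : 0 ≤ 2 * (κ + 1) + 16 * R * c * k₁ := by positivity
      linarith
    refine ⟨1 + k₂ / (1 - a), by positivity, fun X u hX hu huX T T' hT hT' =>
      ⟨fun _ => ?_, fun h => absurd h ha.ne⟩⟩
    obtain ⟨hTle, hTle', -, -⟩ := hceil X u hX hu huX T T' hT hT'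
    have hX0 : 0 < X := by linarith
    have hY : 1 ≤ X ^ (1 / a - 1) := Real.one_le_rpow hX (by
      rw [sub_nonneg, le_div_iff₀ ha₀]
      linarith)
    have hXa : 1 ≤ X ^ (1 / a) := Real.one_le_rpow hX (by positivity)
    have hXY : X * X ^ (1 / a - 1) = X ^ (1 / a) := by
      rw [Real.rpow_sub hX0, Real.rpow_one]
      field_simp
    have hp := powSum_le_of_le_mul_rpow ha₀ ha (by linarith : 1 ≤ κ + 1) hX hTle
    have h1 : c + c * powSum a T ≤ c * (k₁ * X ^ (1 / a - 1)) := by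
      have : 1 + powSum a T ≤ k₁ * X ^ (1 / a - 1) := by
        rw [hk₁]
        linarith
      nlinarith
    have h2 : 16 * R * (c + c * powSum a T) * u ≤ 16 * R * c * k₁ * X ^ (1 / a) := by
      calc _ ≤ 16 * R * (c * (k₁ * X ^ (1 / a - 1))) * X := by gcongr
        _ = 16 * R * c * k₁ * (X * X ^ (1 / a - 1)) := by ring
        _ = _ := by rw [hXY]
    have h3 : (T' : ℝ) ≤ k₂ * X ^ (1 / a) := by
      rw [hk₂]
      linarith
    have h4 := powSum_le_of_le_mul_rpow ha₀ ha hk₂1 hX h3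
    linarith
  · set k₂ := 2 * (κ + 1) + 16 * R * c * (κ + 2) + 1 with hk₂
    have hk₂1 : 1 ≤ k₂ := by
      have : 0 ≤ 2 * (κ + 1) + 16 * R * c * (κ + 2) := by positivity
      linarith
    have hlogk : 0 ≤ Real.log k₂ := Real.log_nonneg hk₂1
    refine ⟨2 + Real.log k₂, by positivity, fun X u hX hu huX T T' hT hT' =>
      ⟨fun h => absurd h (lt_irrefl _), fun _ => ?_⟩⟩
    obtain ⟨hTle, hTle', hT1, hT1'⟩ := hceil X u hX hu huX T T' hT hT'
    rw [div_one, Real.rpow_one] at hTle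
    have hT0 : (0 : ℝ) < T := by exact_mod_cast hT1
    have hT0' : (0 : ℝ) < T' := by exact_mod_cast hT1'
    have hX0 : 0 < X := by linarith
    -- This crude bound makes T' of order X² when a = 1, which is harmless as only log T' matters.
    have h1 : powSum 1 T ≤ T := (powSum_one_le T).trans (by
      linarith [Real.log_le_sub_one_of_pos hT0])
    have h2 : c + c * powSum 1 T ≤ c * ((κ + 2) * X) := by
      have : 1 + powSum 1 T ≤ (κ + 2) * X := by linarith
      nlinarith
    have hXX : X ≤ X ^ 2 := by nlinarith
    have h3 : 16 * R * (c + c * powSum 1 T) * u ≤ 16 * R * c * (κ + 2) * X ^ 2 := by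
      calc _ ≤ 16 * R * (c * ((κ + 2) * X)) * X := by gcongr
        _ = _ := by ring
    have h4 : (T' : ℝ) ≤ k₂ * X ^ 2 := by
      rw [hk₂]
      nlinarith
    have h5 : Real.log T' ≤ Real.log k₂ + 2 * Real.log X := by
      have := Real.log_le_log hT0' h4
      rwa [Real.log_mul (by positivity) (by positivity), Real.log_pow] at this
    have h6 := powSum_one_le T'
    have hlogX : 0 ≤ Real.log X := Real.log_nonneg hX
    nlinarith

end BurnIn

/-! ### Cumulative step sizes as sums of powers -/

section TotalStep

variable {a c η₀ : ℝ}

theorem totalStep_stepSize {t : ℕ} (ht : 1 ≤ t) :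
    totalStep (stepSize a c η₀) t = η₀ + c * powSum a t := by
  rw [totalStep, Finset.range_eq_Ico, Finset.sum_eq_sum_Ico_succ_bot (by omega), powSum,
    Finset.mul_sum]
  congr 1
  exact Finset.sum_congr rfl fun j hj => stepSize_of_pos (Finset.mem_Ico.1 hj).1

theorem totalStep_stepSize_le (hc : 0 < c) (h1 : η₀ ≤ c) (t : ℕ) :
    totalStep (stepSize a c η₀) t ≤ c + c * powSum a t := by
  rcases Nat.eq_zero_or_pos t with rfl | ht
  · simp only [totalStep, Finset.range_zero, Finset.sum_empty]
    have := powSum_nonneg a 0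
    positivity
  · rw [totalStep_stepSize ht]
    linarith

theorem le_totalStep_stepSize (h0 : 0 ≤ η₀) {t : ℕ} (ht : 1 ≤ t) :
    c * powSum a t ≤ totalStep (stepSize a c η₀) t := by
  rw [totalStep_stepSize ht]
  linarith

theorem sum_stepSize_sq_le {T t : ℕ} (hT : 1 ≤ T) :
    ∑ s ∈ Finset.Ico T t, stepSize a c η₀ s ^ 2 ≤ c ^ 2 * powSum (2 * a) t := by
  rw [powSum, Finset.mul_sum]
  calc ∑ s ∈ Finset.Ico T t, stepSize a c η₀ s ^ 2
      = ∑ s ∈ Finset.Ico T t, c ^ 2 * (s : ℝ) ^ (-(2 * a)) := by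
        refine Finset.sum_congr rfl fun s hs => ?_
        rw [stepSize_of_pos (hT.trans (Finset.mem_Ico.1 hs).1), mul_pow, ← Real.rpow_natCast,
          ← Real.rpow_natCast, ← Real.rpow_mul (by positivity)]
        congr 2
        push_cast
        ring
    _ ≤ _ := Finset.sum_le_sum_of_subset_of_nonneg (Finset.Ico_subset_Ico_left hT)
        fun s _ _ => by positivity

end TotalStep

end VRSteepest

namespace VRSteepest

variable {n k d : ℕ} {N : Matrix (Fin k) (Fin d) ℝ → ℝ} {x : Fin n → Fin d → ℝ}
  {y : Fin n → Fin k} {a c R γ β η₀ : ℝ} {m b : ℕ} {B : ℕ → Finset (Fin n)}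
  {W : ℕ → Matrix (Fin k) (Fin d) ℝ}

/-! ### Margin bounds after the burn-in -/

/-- The constant in front of the quadratic term of the descent inequality. -/
noncomputable def driftConst (c R : ℝ) : ℝ := 2 * (192 * R ^ 2 + 32 * R / c) + 4 * R ^ 2

theorem driftConst_pos (hc : 0 < c) (hR : 0 < R) : 0 < driftConst c R := by
  unfold driftConst
  positivity

/-- Lower bound for the margin after the burn-in time. -/
theorem le_minMargin (ha₀ : 0 < a) (ha₁ : a ≤ 1) (hc : 0 < c) (hR : 0 < R) (hγ : 0 < γ)
    (hm : 1 ≤ m) (hb : 1 ≤ b) (hn : n = m * b) (hβ0 : 0 ≤ β) (hβ1 : β < 1) (hk : 2 ≤ k)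
    (hN : IsEntryDominatingNorm N) (hx : ∀ i, ∑ j, |x i j| ≤ R) (hmax : maxMargin N x y = γ)
    (hB : ∀ t, (B t).card = b) (h0 : 0 ≤ η₀) {D : ℕ → Matrix (Fin k) (Fin d) ℝ}
    (hD : ∀ t, IsSteepest N (momentum β (vrGrad x y m B W) t) (D t))
    (hW : ∀ t, W (t + 1) = W t - stepSize a c η₀ t • D t)
    {X : ℝ} (hX : X * (1 - β) = m ^ 2) {T T' : ℕ}
    (hT : ∀ t : ℕ, T ≤ t → 4 * X ≤ t ∧
      X * stepSize a c η₀ t ≤ min (1 / (16 * R)) (γ / (2 * driftConst c R)))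
    (hTT' : 2 * T ≤ T') (hT' : 16 * R * totalStep (stepSize a c η₀) T ≤ (1 - β) * T')
    {t : ℕ} (ht : T' ≤ t) :
    ∑ s ∈ Finset.Ico T' t, stepSize a c η₀ s * (γ - driftConst c R * (X * stepSize a c η₀ s))
        - n * fullLoss x y (W T') ≤ minMargin x y (W t) ∧
      γ / 2 * (totalStep (stepSize a c η₀) t - totalStep (stepSize a c η₀) T')
        - n * fullLoss x y (W T') ≤ minMargin x y (W t) := by
  have hn0 : 0 < n := hn ▸ Nat.mul_pos hm hb
  have hη := stepSize_nonneg (a := a) hc h0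
  have hA := driftConst_pos hc hR
  have hm' : (1 : ℝ) ≤ m := by exact_mod_cast hm
  have hX1 : 1 ≤ X := by nlinarith
  set M := momentum β (vrGrad x y m B W) with hM
  have hrec : ErrorRecursion R β m (stepSize a c η₀) (relError x y W M) :=
    ⟨relError_zero_le hn0 hk hx hβ0 hβ1 m B, fun t =>
      relError_succ_le hN hη (fun t => (hD t).1) hW hk hR.le hx hβ0 hβ1 hm hb hn hB t⟩
  have herr : ∀ s, T' ≤ s → relError x y W M s ≤
      (192 * R ^ 2 + 32 * R / c) * (X * stepSize a c η₀ s) := fun s hs =>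
    hrec.le_stepSize (relError_nonneg hn0 hk M) ha₀ ha₁ hc h0 hR hβ0 hβ1 hm hX
      (fun t ht => ⟨(hT t ht).1, (hT t ht).2.trans (min_le_left _ _)⟩) hTT' hT' hs
  -- The second entry of the minimum in `hT` keeps the drift below γ/2. Hence the decrements are
  -- nonnegative, and the cruder second bound follows, used later only for positivity of the margin.
  have hhalf : ∀ s, T' ≤ s → γ / 2 ≤ γ - driftConst c R * (X * stepSize a c η₀ s) := by
    intro s hs
    have h1 := (hT s (by omega)).2.trans (min_le_right _ _)
    have h2 := mul_le_mul_of_nonneg_left h1 hA.le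
    have e : driftConst c R * (γ / (2 * driftConst c R)) = γ / 2 := by field_simp
    linarith
  have hstep : ∀ s, T' ≤ s → fullLoss x y (W (s + 1)) ≤ fullLoss x y (W s)
      - stepSize a c η₀ s * (γ - driftConst c R * (X * stepSize a c η₀ s))
        * avgMiss x y (W s) := by
    intro s hs
    have hηs := hη s
    have hηX : stepSize a c η₀ s ≤ X * stepSize a c η₀ s := le_mul_of_one_le_left hηs hX1
    have h1 := (hT s (by omega)).2.trans (min_le_left _ _)
    have h2 : 2 * R * stepSize a c η₀ s ≤ 1 := by
      have := mul_le_mul_of_nonneg_left (hηX.trans h1) hR.le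
      have e : R * (1 / (16 * R)) = 1 / 16 := by field_simp
      linarith
    refine (fullLoss_succ_le hN hD hW hn0 hk hx hγ hmax hηs h2).trans ?_
    have hG := (avgMiss_pos (x := x) (y := y) hn0 hk (W s)).le
    have h3 := herr s hs
    have h4 : 4 * R ^ 2 * stepSize a c η₀ s ≤ 4 * R ^ 2 * (X * stepSize a c η₀ s) := by gcongr
    have h5 : γ - driftConst c R * (X * stepSize a c η₀ s) ≤
        γ - 2 * relError x y W M s - 4 * R ^ 2 * stepSize a c η₀ s := by
      rw [driftConst]
      linarith
    gcongr
  have hpot := exp_loss_sub_one_le (L := fun s => fullLoss x y (W s))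
    (G := fun s => avgMiss x y (W s)) (n := n) (Nat.cast_nonneg n)
    (fun s => fullLoss_nonneg _)
    (fun s hs => mul_nonneg (hη s) ((half_pos hγ).le.trans (hhalf s hs)))
    (fun s => one_sub_exp_neg_le hn0 _) hstep ht
  have hmar := (exp_neg_minMargin_le (x := x) (y := y) hn0 hk (W t)).trans hpot
  rw [Real.exp_le_exp] at hmar
  refine ⟨by linarith, ?_⟩
  have hsum : γ / 2 * (totalStep (stepSize a c η₀) t - totalStep (stepSize a c η₀) T') ≤
      ∑ s ∈ Finset.Ico T' t,
        stepSize a c η₀ s * (γ - driftConst c R * (X * stepSize a c η₀ s)) := by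
    rw [totalStep, totalStep, ← Finset.sum_Ico_eq_sub _ ht, Finset.mul_sum]
    refine Finset.sum_le_sum fun s hs => ?_
    rw [mul_comm]
    exact mul_le_mul_of_nonneg_left (hhalf s (Finset.mem_Ico.1 hs).1) (hη s)
  linarith

/-- The margin gap at a fixed time after the burn-in. -/
theorem marginGap_le (ha₀ : 0 < a) (ha₁ : a ≤ 1) (hc : 0 < c) (hR : 0 < R) (hγ : 0 < γ)
    (hm : 1 ≤ m) (hb : 1 ≤ b) (hn : n = m * b) (hβ0 : 0 ≤ β) (hβ1 : β < 1) (hk : 2 ≤ k)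
    (hN : IsEntryDominatingNorm N) (hx : ∀ i, ∑ j, |x i j| ≤ R) (hmax : maxMargin N x y = γ)
    (hB : ∀ t, (B t).card = b) (h0 : 0 ≤ η₀) (h1 : η₀ ≤ c)
    (hW : IsVRTrajectory N x y m B β (stepSize a c η₀) W)
    {X ω Λ : ℝ} (hω : N (W 0) ≤ ω) (hΛ : fullLoss x y (W 0) ≤ Λ)
    (hX : X * (1 - β) = m ^ 2) {T T' : ℕ}
    (hT : ∀ t : ℕ, T ≤ t → 4 * X ≤ t ∧
      X * (c * (t : ℝ) ^ (-a)) ≤ min (1 / (16 * R)) (γ / (2 * driftConst c R)))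
    (hTT' : 2 * T ≤ T') (hT' : 16 * R * (c + c * powSum a T) ≤ (1 - β) * T')
    {t : ℕ} (ht : T' ≤ t) (htpos : 0 < powSum a t)
    (hlarge : n * (|Λ| + 2 * R * (c + c * powSum a T')) <
      γ / 2 * (c * powSum a t - (c + c * powSum a T'))) :
    W t ≠ 0 ∧ marginGap N x y (W t) ≤
      (γ * |ω| + |Λ| + (γ + 2 * R) * c + driftConst c R * c ^ 2) / c *
        ((n * (1 + powSum a T') + X * powSum (2 * a) t) / powSum a t) := by
  obtain ⟨D, hDW⟩ := hW
  have hD := fun t => (hDW t).1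
  have hWs := fun t => (hDW t).2
  have hn0 : 0 < n := hn ▸ Nat.mul_pos hm hb
  have hn1 : (1 : ℝ) ≤ n := by exact_mod_cast hn0
  have hη := stepSize_nonneg (a := a) hc h0
  have hA := driftConst_pos hc hR
  have hm' : (1 : ℝ) ≤ m := by exact_mod_cast hm
  have hX1 : 1 ≤ X := by nlinarith
  have hTone : ∀ s, T ≤ s → 1 ≤ s := by
    intro s hs
    have : (1 : ℝ) ≤ s := by linarith [(hT s hs).1]
    exact_mod_cast this
  have hT'1 : 1 ≤ T' := hTone T' (by omega)
  have ht1 : 1 ≤ t := hT'1.trans ht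
  have hTle := totalStep_stepSize_le (a := a) hc h1 T
  have hT'le := totalStep_stepSize_le (a := a) hc h1 T'
  have htle := le_totalStep_stepSize (a := a) (c := c) h0 ht1
  obtain ⟨hm1, hm2⟩ := le_minMargin ha₀ ha₁ hc hR hγ hm hb hn hβ0 hβ1 hk hN hx hmax hB h0 hD hWs
    hX (T := T) (T' := T') (fun s hs => by
      rw [stepSize_of_pos (hTone s hs)]
      exact hT s hs) hTT' ((mul_le_mul_of_nonneg_left hTle (by positivity)).trans hT') ht
  set S := totalStep (stepSize a c η₀) t
  set S' := totalStep (stepSize a c η₀) T'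
  have hL : fullLoss x y (W T') ≤ |Λ| + 2 * R * (c + c * powSum a T') := by
    have := fullLoss_le_add (y := y) hn0 hx
      (r := S') (Finset.sum_nonneg fun s _ => hη s)
      (W := W 0) (W' := W T') fun c' j => by
        have := abs_iterate_sub_le hN hη (fun t => (hD t).1) hWs (Nat.zero_le T') c' j
        rwa [show totalStep (stepSize a c η₀) 0 = 0 from rfl, sub_zero] at this
    have h2 := mul_le_mul_of_nonneg_left hT'le hR.le
    linarith [le_abs_self Λ]
  have hnL := mul_le_mul_of_nonneg_left hL (Nat.cast_nonneg n : (0 : ℝ) ≤ n)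
  have hmpos : 0 < minMargin x y (W t) := by
    have : γ / 2 * (c * powSum a t - (c + c * powSum a T')) ≤ γ / 2 * (S - S') := by
      gcongr
    linarith
  have hWne : W t ≠ 0 := by
    intro h
    rw [h, minMargin_zero hn0 hk] at hmpos
    exact lt_irrefl _ hmpos
  refine ⟨hWne, ?_⟩
  have hNpos : 0 < N (W t) := by
    by_contra hcon
    refine hWne (Matrix.ext fun c' j => ?_)
    have := (hN.entry_le (W t) c' j).trans (not_lt.1 hcon)
    simpa using this
  have hNle : N (W t) ≤ |ω| + S :=
    (norm_iterate_le hN hη (fun t => (hD t).1) hWs t).trans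
      (by linarith [le_abs_self ω])
  have hsq := sum_stepSize_sq_le (a := a) (c := c) (η₀ := η₀) (t := t) hT'1
  have hsum : ∑ s ∈ Finset.Ico T' t,
      stepSize a c η₀ s * (γ - driftConst c R * (X * stepSize a c η₀ s))
      = γ * (S - S') - driftConst c R * X * ∑ s ∈ Finset.Ico T' t, stepSize a c η₀ s ^ 2 := by
    have : S - S' = ∑ s ∈ Finset.Ico T' t, stepSize a c η₀ s :=
      (Finset.sum_Ico_eq_sub _ ht).symm
    rw [this, Finset.mul_sum, Finset.mul_sum, ← Finset.sum_sub_distrib]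
    exact Finset.sum_congr rfl fun s _ => by ring
  rw [hsum] at hm1
  have hp' := powSum_nonneg a T'
  have hp2 := powSum_nonneg (2 * a) t
  have hcp : 0 < c * powSum a t := by positivity
  have hden : 0 < |ω| + S := hNpos.trans_le hNle
  -- The losses against γ times the norm bound: initial norm, steps before T', n times the loss at
  -- T', and the quadratic drift.
  set Q := γ * |ω| + γ * (c + c * powSum a T') + n * (|Λ| + 2 * R * (c + c * powSum a T'))
    + driftConst c R * X * (c ^ 2 * powSum (2 * a) t) with hQ
  have hQ0 : 0 ≤ Q := by positivity
  have hnum : γ * (|ω| + S) - minMargin x y (W t) ≤ Q := by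
    have h2 := mul_le_mul_of_nonneg_left hsq (by positivity : 0 ≤ driftConst c R * X)
    have h3 := mul_le_mul_of_nonneg_left hT'le hγ.le
    linarith
  have hgap : marginGap N x y (W t) ≤ Q / (c * powSum a t) := by
    rw [marginGap, hmax]
    -- Enlarging the denominator is allowed because the margin is already known to be positive.
    calc γ - minMargin x y (W t) / N (W t) ≤ γ - minMargin x y (W t) / (|ω| + S) := by gcongr
      _ = (γ * (|ω| + S) - minMargin x y (W t)) / (|ω| + S) := by field_simp
      _ ≤ Q / (|ω| + S) := by gcongr
      _ ≤ Q / (c * powSum a t) := by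
          gcongr
          linarith [abs_nonneg ω]
  refine hgap.trans ?_
  have hP1 : (1 : ℝ) ≤ n * (1 + powSum a T') := by nlinarith
  have hQle : Q ≤ (γ * |ω| + |Λ| + (γ + 2 * R) * c + driftConst c R * c ^ 2) *
      (n * (1 + powSum a T') + X * powSum (2 * a) t) := by
    set P := n * (1 + powSum a T') with hP
    have e1 : 1 + powSum a T' ≤ P := le_mul_of_one_le_left (by positivity) hn1
    have e2 : (n : ℝ) ≤ P := le_mul_of_one_le_right (by positivity) (by linarith)
    have f1 : γ * |ω| * 1 ≤ γ * |ω| * P := by gcongr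
    have f2 : γ * c * (1 + powSum a T') ≤ γ * c * P := by gcongr
    have f3 : |Λ| * n ≤ |Λ| * P := by gcongr
    have hr : 0 ≤ (γ * |ω| + |Λ| + (γ + 2 * R) * c) * (X * powSum (2 * a) t)
        + driftConst c R * c ^ 2 * P := by positivity
    have hQe : Q = γ * |ω| * 1 + γ * c * (1 + powSum a T') + |Λ| * n + 2 * R * c * P
        + driftConst c R * c ^ 2 * (X * powSum (2 * a) t) := by
      rw [hQ, hP]
      ring
    rw [hQe]
    linarith
  rw [div_mul_div_comm]
  gcongr

/-- Times after which the bound of `marginGap_le` applies to all trajectories. -/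
theorem exists_time_large (ha₁ : a ≤ 1) (hc : 0 < c) (hγ : 0 < γ) (q p : ℝ) (T : ℕ) :
    ∃ t₂ : ℕ, ∀ t : ℕ, t₂ < t → 2 ≤ t ∧ T ≤ t ∧ 0 < powSum a t ∧
      q < γ / 2 * (c * powSum a t - p) := by
  have hlim : Filter.Tendsto (fun t : ℕ => Real.log t) Filter.atTop Filter.atTop :=
    Real.tendsto_log_atTop.comp tendsto_natCast_atTop_atTop
  obtain ⟨t₂, h⟩ := Filter.eventually_atTop.1
    (hlim.eventually_gt_atTop (max 0 ((q / (γ / 2) + p) / c)))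
  refine ⟨max t₂ (max T 2), fun t ht => ?_⟩
  have h1 := h t (le_of_lt (lt_of_le_of_lt (le_max_left _ _) ht))
  have ht2 : 2 ≤ t := by omega
  have h2 := h1.trans_le (log_le_powSum ha₁ (by omega : 1 ≤ t))
  rw [max_lt_iff] at h2
  refine ⟨ht2, by omega, h2.1, ?_⟩
  have h3 := h2.2
  rw [div_lt_iff₀ hc] at h3
  have h4 : q / (γ / 2) < c * powSum a t - p := by linarith
  rw [div_lt_iff₀ (half_pos hγ)] at h4
  linarith

/-- Growth of the sums of squared step sizes. -/
theorem exists_powSum_two_mul_le (ha₀ : 0 < a) :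
    ∃ Z : ℝ, 1 ≤ Z ∧ ∀ t : ℕ,
      (a < 1 / 2 → powSum (2 * a) t ≤ Z * (t : ℝ) ^ (1 - 2 * a)) ∧
      (1 / 2 < a → powSum (2 * a) t ≤ Z) := by
  rcases lt_trichotomy a (1 / 2) with ha | ha | ha
  · have h : 0 < 1 - 2 * a := by linarith
    refine ⟨1 / (1 - 2 * a), by rw [le_div_iff₀ h]; linarith, fun t =>
      ⟨fun _ => ?_, fun h' => absurd h' ha.not_gt⟩⟩
    refine (powSum_le_of_lt_one (by linarith) (by linarith) t).trans (le_of_eq ?_)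
    ring
  · exact ⟨1, le_rfl, fun t => ⟨fun h => absurd h ha.not_lt, fun h => absurd h ha.not_gt⟩⟩
  · refine ⟨max 1 (∑' j : ℕ, (j : ℝ) ^ (-(2 * a))), le_max_left _ _, fun t =>
      ⟨fun h' => absurd h' ha.not_gt, fun _ => ?_⟩⟩
    exact (powSum_le_tsum (by linarith) t).trans (le_max_right _ _)

theorem combine_bounds {K Z u v P S u' v' : ℝ} (hK : 0 < K) (hZ : 1 ≤ Z) (hu' : u ≤ K * u')
    (hv' : v ≤ Z * v') (hP : 0 < P) (hS : P / 2 ≤ S) (hu0 : 0 ≤ u') (hv0 : 0 ≤ v') :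
    (u + v) / S ≤ 2 * (K + Z) * ((u' + v') / P) := by
  have h1 : u + v ≤ (K + Z) * (u' + v') := by nlinarith
  have h0 : 0 ≤ (K + Z) * (u' + v') := by positivity
  calc (u + v) / S ≤ (K + Z) * (u' + v') / (P / 2) := by gcongr
    _ = _ := by field_simp

end VRSteepest

/-! ### The four step-size regimes -/

open VRSteepest in
theorem corollary4p7
    (a c R γ ω Λ : ℝ) (ha₀ : 0 < a) (ha₁ : a ≤ 1) (hc : 0 < c) (hR : 0 < R) (hγ : 0 < γ) :
    ∃ C : ℝ, 0 < C ∧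
    ∀ (n m b : ℕ) (β : ℝ), 1 ≤ m → 1 ≤ b → n = m * b → 0 ≤ β → β < 1 →
    ∃ t₂ : ℕ,
    ∀ (k d : ℕ) (N : Matrix (Fin k) (Fin d) ℝ → ℝ)
      (x : Fin n → Fin d → ℝ) (y : Fin n → Fin k) (B : ℕ → Finset (Fin n)) (η₀ : ℝ)
      (W : ℕ → Matrix (Fin k) (Fin d) ℝ),
      2 ≤ k →
      VRSteepest.IsEntrywiseOrSchatten N →
      VRSteepest.Separable x y →
      (∀ i, ∑ j, |x i j| ≤ R) →
      VRSteepest.maxMargin N x y = γ →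
      VRSteepest.IsReshuffling m b B →
      0 ≤ η₀ → η₀ ≤ c →
      VRSteepest.IsVRTrajectory N x y m B β (VRSteepest.stepSize a c η₀) W →
      N (W 0) ≤ ω → VRSteepest.fullLoss x y (W 0) ≤ Λ →
      ∀ t : ℕ, t₂ < t →
        W t ≠ 0 ∧
        (a < 1 / 2 →
          VRSteepest.marginGap N x y (W t) ≤
            C * ((n * ((m : ℝ) ^ (2 + a) / (1 - β)) ^ (1 / a - 1)
              + (m : ℝ) ^ (2 + a) / (1 - β) * (t : ℝ) ^ (1 - 2 * a)) / (t : ℝ) ^ (1 - a))) ∧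
        (a = 1 / 2 →
          VRSteepest.marginGap N x y (W t) ≤
            C * ((m : ℝ) ^ (5 / 2 : ℝ) / (1 - β) * (n + Real.log t) / (t : ℝ) ^ (1 / 2 : ℝ))) ∧
        (1 / 2 < a → a < 1 →
          VRSteepest.marginGap N x y (W t) ≤
            C * ((n * ((m : ℝ) ^ (2 + a) / (1 - β)) ^ (1 / a - 1)
              + (m : ℝ) ^ (2 + a) / (1 - β)) / (t : ℝ) ^ (1 - a))) ∧
        (a = 1 →
          VRSteepest.marginGap N x y (W t) ≤
            C * ((n * (1 + Real.log ((m : ℝ) ^ 3 / (1 - β)))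
              + (m : ℝ) ^ 3 / (1 - β)) / Real.log t)) := by
  have hA := driftConst_pos hc hR
  obtain ⟨K, hK, htimes⟩ := exists_times ha₀ ha₁ hc hR
    (ε := min (1 / (16 * R)) (γ / (2 * driftConst c R))) (by positivity)
  obtain ⟨Z, hZ, hZt⟩ := exists_powSum_two_mul_le ha₀
  -- The absolute values keep the constant positive for arbitrary real ω and Λ.
  set C₁ := (γ * |ω| + |Λ| + (γ + 2 * R) * c + driftConst c R * c ^ 2) / c with hC₁
  have hC₁0 : 0 < C₁ := by positivity
  refine ⟨C₁ * (2 * (K + Z)), by positivity, fun n m b β hm hb hn hβ0 hβ1 => ?_⟩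
  have hu : 0 < 1 - β := by linarith
  have hm' : (1 : ℝ) ≤ m := by exact_mod_cast hm
  have hm0 : (0 : ℝ) < m := by linarith
  have hn1 : (1 : ℝ) ≤ n := by
    have : 1 ≤ n := hn ▸ Nat.mul_pos hm hb
    exact_mod_cast this
  have hX : (m : ℝ) ^ 2 / (1 - β) * (1 - β) = m ^ 2 := div_mul_cancel₀ _ hu.ne'
  set X := (m : ℝ) ^ 2 / (1 - β) with hXdef
  have hm2 : (1 : ℝ) ≤ (m : ℝ) ^ 2 := one_le_pow₀ hm'
  have hX1 : 1 ≤ X := by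
    rw [hXdef, le_div_iff₀ hu]
    linarith
  have huX : 1 / (1 - β) ≤ X := by
    rw [hXdef]
    gcongr
  obtain ⟨T, T', hT, hTT', hT', hlt, heq⟩ := htimes X (1 / (1 - β)) hX1 (by positivity) huX
  obtain ⟨t₂, ht₂⟩ := exists_time_large (a := a) ha₁ hc hγ
    (n * (|Λ| + 2 * R * (c + c * powSum a T'))) (c + c * powSum a T') T'
  refine ⟨t₂, fun k d N x y B η₀ W hk hN _ hx hmax hB h0 h1 hW hω hΛ t ht => ?_⟩
  obtain ⟨ht2, hT't, htpos, hlarge⟩ := ht₂ t ht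
  obtain ⟨hWne, hgap⟩ := marginGap_le ha₀ ha₁ hc hR hγ hm hb hn hβ0 hβ1 hk
    hN.isEntryDominatingNorm hx hmax hB.1 h0 h1 hW hω hΛ hX hT hTT'
    (by
      rw [mul_one_div, div_le_iff₀ hu] at hT'
      linarith) hT't htpos hlarge
  rw [← hC₁] at hgap
  have ht0 : (0 : ℝ) < t := by
    have : 0 < t := by omega
    exact_mod_cast this
  have hlogt : 0 ≤ Real.log t := Real.log_natCast_nonneg t
  -- The argument yields m² in place of m^{2+a}; the stated power of m is a weakening.
  have hXY : X ≤ (m : ℝ) ^ (2 + a) / (1 - β) := by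
    rw [hXdef, ← Real.rpow_two]
    gcongr
    linarith
  set Y := (m : ℝ) ^ (2 + a) / (1 - β) with hY
  have hY1 : 1 ≤ Y := hX1.trans hXY
  have hpow : (t : ℝ) ^ (1 - a) / 2 ≤ powSum a t := rpow_div_two_le_powSum ha₀.le ht2
  have hbase : a < 1 → n * (1 + powSum a T') ≤ K * (n * Y ^ (1 / a - 1)) := by
    intro ha
    have h1a : 0 ≤ 1 / a - 1 := by
      rw [sub_nonneg, le_div_iff₀ ha₀]
      linarith
    calc n * (1 + powSum a T') ≤ n * (K * X ^ (1 / a - 1)) := by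
          gcongr
          exact hlt ha
      _ ≤ n * (K * Y ^ (1 / a - 1)) := by gcongr
      _ = _ := by ring
  refine ⟨hWne, fun ha => ?_, fun ha => ?_, fun ha ha' => ?_, fun ha => ?_⟩
  · refine hgap.trans ?_
    rw [mul_assoc C₁]
    refine mul_le_mul_of_nonneg_left ?_ hC₁0.le
    refine combine_bounds hK hZ (hbase (by linarith)) ?_ (by positivity) hpow (by positivity)
      (by positivity)
    calc X * powSum (2 * a) t ≤ Y * (Z * (t : ℝ) ^ (1 - 2 * a)) := by
          gcongr
          · exact powSum_nonneg _ _
          · exact (hZt t).1 ha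
      _ = _ := by ring
  · refine hgap.trans ?_
    rw [mul_assoc C₁]
    refine mul_le_mul_of_nonneg_left ?_ hC₁0.le
    have hYe : (m : ℝ) ^ (5 / 2 : ℝ) / (1 - β) = Y := by
      rw [hY, ha]
      norm_num
    have hb := hbase (by linarith)
    have hone : 1 / a - 1 = 1 := by
      rw [ha]
      norm_num
    rw [hone, Real.rpow_one] at hb
    have he : (1 / 2 : ℝ) = 1 - a := by
      rw [ha]
      norm_num
    rw [hYe, he, mul_add Y]
    have htwo : 2 * a = 1 := by linarith
    have hlog : X * powSum (2 * a) t ≤ Y * (n + Real.log t) := by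
      rw [htwo]
      -- The 1 of the harmonic bound is absorbed into n ≥ 1.
      have h1 : powSum 1 t ≤ n + Real.log t := (powSum_one_le t).trans (by linarith)
      gcongr
      exact powSum_nonneg _ _
    have hsum : n * (1 + powSum a T') + X * powSum (2 * a) t ≤
        (K + Z) * (Y * n + Y * Real.log t) := by
      have h0 : 0 ≤ Y * n + Y * Real.log t := by positivity
      have h1 : K * (n * Y) ≤ K * (Y * n + Y * Real.log t) := by
        have : 0 ≤ Y * Real.log t := by positivity
        gcongr
        linarith
      nlinarith
    calc _ ≤ (K + Z) * (Y * n + Y * Real.log t) / ((t : ℝ) ^ (1 - a) / 2) := by gcongr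
      _ = _ := by field_simp
  · refine hgap.trans ?_
    rw [mul_assoc C₁]
    refine mul_le_mul_of_nonneg_left ?_ hC₁0.le
    refine combine_bounds hK hZ (hbase ha') ?_ (by positivity) hpow (by positivity)
      (by positivity)
    calc X * powSum (2 * a) t ≤ Y * Z := by
          gcongr
          · exact powSum_nonneg _ _
          · exact (hZt t).2 ha
      _ = _ := by ring
  · refine hgap.trans ?_
    rw [mul_assoc C₁]
    refine mul_le_mul_of_nonneg_left ?_ hC₁0.le
    have hX3 : X ≤ (m : ℝ) ^ 3 / (1 - β) := by
      rw [hXdef]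
      gcongr
      norm_num
    have hlogX : Real.log X ≤ Real.log ((m : ℝ) ^ 3 / (1 - β)) :=
      Real.log_le_log (by linarith) hX3
    have hlogX0 : 0 ≤ Real.log X := Real.log_nonneg hX1
    have hlt0 : 0 < Real.log t := Real.log_pos (by exact_mod_cast ht2)
    refine combine_bounds hK hZ ?_ ?_ hlt0 ?_ ?_ (by positivity)
    · calc n * (1 + powSum a T') ≤ n * (K * (1 + Real.log X)) := by
            gcongr
            exact heq ha
        _ ≤ n * (K * (1 + Real.log ((m : ℝ) ^ 3 / (1 - β)))) := by gcongr
        _ = _ := by ring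
    · calc X * powSum (2 * a) t ≤ (m : ℝ) ^ 3 / (1 - β) * Z := by
            gcongr
            · exact powSum_nonneg _ _
            · exact (hZt t).2 (by linarith)
        _ = _ := by ring
    · have := log_le_powSum ha₁ (by omega : 1 ≤ t)
      linarith
    · have : 0 ≤ 1 + Real.log ((m : ℝ) ^ 3 / (1 - β)) := by linarith
      positivity
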